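/- **Theorem (Triangle paths for companions).** Let $m,n\ge 0$ be coprime integers, let $\omega=\frac12(1+i\sqrt3)$ and $z=m+n\omega$, let $k\ge 2$ be an integer, and fix a sign $\pm$. For $\varepsilon>0$ let $$\beta^{\pm}:[0,1]\to\mathbb C,\qquad \beta^{\pm}(t)=\bigl(t\pm i\,\varepsilon\,t(1-t)\bigr)\,k z ,$$ which is the segment from $0$ to $kz$ bent to the left ($+$) or to the right ($-$). Call $\varepsilon$ *admissible* if no point of the Eisenstein lattice $\mathbb Z+\omega\mathbb Z$ lies on $\beta^{\pm}$ with $0<t<1$ or strictly between $\beta^{\pm}$ and the straight segment from $0$ to $kz$. Let $\tau_0,\dots,\tau_N$ be the successive triangles of the Eisenstein lattice crossed by $\beta^\pm$, and label vertices with fractions as follows. The vertices $0,1,\omega$ get the labels $\frac10,\frac01,\frac11$; in the one case $(m,n)=(1,0)$ with sign $-$, the label $\infty$ at $0$ is written as $\frac{-1}{0}$. Then, for $j=0,\dots,N$ (where nothing is done for $j=0$ if $\tau_0=[0,1,\omega]$), $\tau_j$ is required to have exactly one vertex not labelled so far, and this vertex gets the Farey sum $\frac{p_1+p_2}{q_1+q_2}$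 of the labels $\frac{p_1}{q_1},\frac{p_2}{q_2}$ of the two other vertices of $\tau_j$. Let $\frac pq=\mu_{n/m}$ be the Markov fraction with index $\frac nm$. Here $\mu:\mathbb Q_{\ge0}\cup\{\infty\}\to[0,1]$ is the correspondence of faces under the isomorphism of rooted plane trees from the Stern–Brocot tree (root edge between the faces $\frac01$ below and $\frac10$ above; a new face $\frac{p_1+p_2}{q_1+q_2}$ at the end of the edge between $\frac{p_1}{q_1}$ below and $\frac{p_2}{q_2}$ above) to the tree of Markov fractions (root edge between $\frac01$ below and $\frac11$ above; a new face $\frac{p'}{q'}$ with $p'=\frac{p_1q_1+p_2q_2}{p_2q_1-p_1q_2}$, $q'=\frac{q_1^2+q_2^2}{p_2q_1-p_1q_2}$). Let $u_0=0$, $u_1=1$, $u_{j+1}=3q\,u_j-u_{j-1}$. Then all sufficiently small $\varepsilon>0$ are admissible, and for them the labelling can be carried out. For every admissible $\varepsilon>0$ for which it can be carried out, $kz$ is a vertex of the last triangle, and its label is $$\gamma_k^{\pm}\Bigl(\frac pq\Bigr)=\frac pq\pm\frac{u_{k-1}}{q\,u_k},$$ the $(k-1)$st right ($+$) or left ($-$)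 companion of $\frac pq$. -/

import Mathlib

/-- `ω = (1 + i√3) / 2`. -/
noncomputable def eisOmega : ℂ := (1 + Complex.I * (Real.sqrt 3 : ℂ)) / 2

/-- The point `a + b ω` of the Eisenstein lattice `ℤ + ω ℤ`, given by its coordinates `(a, b)`. -/
noncomputable def eisPoint (v : ℤ × ℤ) : ℂ := (v.1 : ℂ) + (v.2 : ℂ) * eisOmega

/-- The triangles of the Eisenstein lattice, given by their sets of vertices:
`[v, v + 1, v + ω]` and `[v + 1, v + ω, v + 1 + ω]`. -/
def IsEisTriangle (T : Finset (ℤ × ℤ)) : Prop :=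
  ∃ v : ℤ × ℤ, T = {v, v + (1, 0), v + (0, 1)} ∨ T = {v + (1, 0), v + (0, 1), v + (1, 1)}

/-- The closed triangle in the plane with vertex set `T`. -/
noncomputable def eisRegion (T : Finset (ℤ × ℤ)) : Set ℂ :=
  convexHull ℝ (eisPoint '' (T : Set (ℤ × ℤ)))

/-- The bent segment `β^±(t) = (t ± i ε t (1 - t)) k z_{m,n}`, where `z_{m,n} = m + n ω` and the sign
is `s`. For `ε > 0`, `s = 1` bends to the left and `s = -1` bends to the right. -/
noncomputable def bentSegment (m n k : ℕ) (s : ℤˣ) (ε : ℝ) (t : ℝ) : ℂ :=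
  ((t : ℂ) + ((s : ℤ) : ℂ) * Complex.I * (ε : ℂ) * (t : ℂ) * (1 - (t : ℂ))) *
    ((k : ℂ) * eisPoint ((m : ℤ), (n : ℤ)))

/-- There is no lattice point in the interior of the curve `β^±` (the case `r = 1`), and none strictly
between this curve and the straight segment from `0` to `k z_{m,n}` (the cases `0 < r < 1`). -/
def LatticeFree (m n k : ℕ) (s : ℤˣ) (ε : ℝ) : Prop :=
  ∀ t : ℝ, 0 < t → t < 1 → ∀ r : ℝ, 0 < r → r ≤ 1 →
    ∀ v : ℤ × ℤ, eisPoint v ≠ bentSegment m n k s (r * ε) t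

/-- `τ 0, …, τ N` is the sequence of lattice triangles crossed by the curve `c : [0, 1] → ℂ`: during
successive time intervals of positive length the curve runs in `τ 0`, …, `τ N`, and it changes the
triangle from each interval to the next. (A curve `bentSegment` with `ε > 0` contains no straight
piece, so it spends a time interval of positive length in a closed triangle only if it passes
through the interior of the triangle.) -/
def CrossesTriangles (c : ℝ → ℂ) (N : ℕ) (τ : ℕ → Finset (ℤ × ℤ)) : Prop :=
  (∀ j ≤ N, IsEisTriangle (τ j)) ∧
  (∀ j < N, τ j ≠ τ (j + 1)) ∧
  ∃ t : ℕ → ℝ, t 0 = 0 ∧ t (N + 1) = 1 ∧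
    ∀ j ≤ N, t j < t (j + 1) ∧ ∀ x ∈ Set.Icc (t j) (t (j + 1)), c x ∈ eisRegion (τ j)

/-- The vertices that carry a label before the triangle `τ j` is treated: `0`, `1`, `ω`, and the
vertices of the previous triangles. -/
def labelledBefore (τ : ℕ → Finset (ℤ × ℤ)) (j : ℕ) : Finset (ℤ × ℤ) :=
  {(0, 0), (1, 0), (0, 1)} ∪ (Finset.range j).biUnion τ

/-- `L` is a recursive Farey labelling along the triangles `τ 0, …, τ N`. A label `a / b` is stored as
the pair `(a, b)`. The vertex `0` carries the label `e / 0` (with `e = 1` or `e = -1`, two ways of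
writing the fraction `∞`), and `1`, `ω` carry `0/1`, `1/1`. Each triangle has exactly one vertex that
is not yet labelled, except that the first one may be the triangle `[0, 1, ω]`; this vertex gets the
Farey sum `(a₁ + a₂) / (b₁ + b₂)` of the labels at the two other vertices. -/
structure IsFareyLabelling (e : ℤ) (N : ℕ) (τ : ℕ → Finset (ℤ × ℤ)) (L : ℤ × ℤ → ℤ × ℤ) :
    Prop where
  label_zero : L (0, 0) = (e, 0)
  label_one : L (1, 0) = (0, 1)
  label_omega : L (0, 1) = (1, 1)
  label_step : ∀ j ≤ N, (j = 0 ∧ τ 0 = {(0, 0), (1, 0), (0, 1)}) ∨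
    ∃ v, τ j \ labelledBefore τ j = {v} ∧ L v = ∑ w ∈ (τ j).erase v, L w

/-- The fraction that the generating rule of the tree of Markov fractions places between the faces
`p₁/q₁` and `p₂/q₂` (`P = (p₁, q₁)`, `Q = (p₂, q₂)`). In that tree both divisions are exact and the
resulting fraction is in lowest terms. -/
def markovChild (P Q : ℤ × ℤ) : ℤ × ℤ :=
  ((P.1 * P.2 + Q.1 * Q.2) / (Q.1 * P.2 - P.1 * Q.2),
    (P.2 ^ 2 + Q.2 ^ 2) / (Q.1 * P.2 - P.1 * Q.2))

/-- Corresponding edges of the extended Stern-Brocot tree and of the tree of Markov fractions in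
`[0, 1]`: the edge between the faces `a` (below) and `b` (above) of the first tree corresponds to the
edge between the faces `P` (below) and `Q` (above) of the second one. The fraction `n/m` is stored as
the pair `(n, m)`. The root edges are `0/1 | 1/0` and `0/1 | 1/1`. The new face at the end of an edge
is the mediant in the Stern-Brocot tree and `markovChild P Q` in the tree of Markov fractions. -/
inductive TreeEdge : ℕ × ℕ → ℕ × ℕ → ℤ × ℤ → ℤ × ℤ → Prop
  | root : TreeEdge (0, 1) (1, 0) (0, 1) (1, 1)
  | lower {a b : ℕ × ℕ} {P Q : ℤ × ℤ} :
      TreeEdge a b P Q → TreeEdge a (a + b) P (markovChild P Q)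
  | upper {a b : ℕ × ℕ} {P Q : ℤ × ℤ} :
      TreeEdge a b P Q → TreeEdge (a + b) b (markovChild P Q) Q

/-- `p/q` is the Markov fraction `μ_{n/m}`: the faces `n/m` and `p/q` correspond to each other under
the isomorphism of the extended Stern-Brocot tree with the tree of Markov fractions in `[0, 1]`. -/
def IsMarkovFractionAt (n m : ℕ) (p q : ℤ) : Prop :=
  (∃ b Q, TreeEdge (n, m) b (p, q) Q) ∨ (∃ a P, TreeEdge a (n, m) P (p, q))

/-- The sequence `u₀ = 0`, `u₁ = 1`, `u_{k+1} = 3 q u_k - u_{k-1}`. -/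
def companionSeq (q : ℤ) : ℕ → ℤ
  | 0 => 0
  | 1 => 1
  | (k + 2) => 3 * q * companionSeq q (k + 1) - companionSeq q k

/-- The companion `γ^±_k(p/q) = p/q ± u_{k-1} / (q u_k)` (for `k ≥ 2`); the right companions have
`s = 1`, the left ones `s = -1`. -/
def companion (s : ℤˣ) (k : ℕ) (p q : ℤ) : ℚ :=
  (p : ℚ) / q + ((s : ℤ) : ℚ) * ((companionSeq q (k - 1) : ℚ) / (q * companionSeq q k))

/-- The numerator of the label `±1/0` at the vertex `0`. It is `1`, except when the real segment from
`0` to `k` (the case `n = 0`) is bent to the right: there the triangles lie on the other side of the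
edge from `0` to `1`, and `∞` has to be written as `(-1)/0`. -/
def startSign (n : ℕ) (s : ℤˣ) : ℤ := if n = 0 ∧ s = -1 then -1 else 1

/-! The proof joins a combinatorial computation along a strip of triangles to the geometry of the
bent segment.

Combinatorics. The triangles met just to the left of the ray of direction `(m, n)` form a strip.
Between two consecutive lines `x + y = h` it has two triangles, and the Farey rule acts on the pair
of labels of an entry edge by the matrix `A` or `B`, according to whether the lattice path below the
ray steps by `1` or by `ω` (`strip_even`). Hence the label at `kz` is read off from the first column
of the `k`-th power of a period matrix. The period word of a mediant is the concatenation of the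
words of its two parents (`periodMatrix_add`), so the period matrices obey the recursion of the
Markov tree: they are Cohn matrices with entries given by `p, q`, trace `3q` and determinant `1`
(`TreeEdge.spec`). Cayley–Hamilton expresses the powers through `u_k` (`pow_eq_companionSeq`), and
the companion appears.

Geometry. The crossed triangles must be shown to form this strip. It suffices that every exit edge
is mixed (one end on each side of the ray), that the path does not turn back, and that it starts
correctly (`MixedPath.eq_strip`). For small bends this is direct: left lattice points have an
integer form value at least `1`, while the curve stays below `1`. For a general admissible bend the
labelling itself helps: each triangle brings a new vertex, so no triangle is repeated. An exit edge
with both ends on the left would have both ends above a concave parabola, so the curve would meet it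
twice and revisit a triangle, or touch it without changing sides
(`PlaneCrossing.mixed_of_injective`).

Right bends are reduced to left bends by interchanging the two lattice coordinates. -/

/-! ### Words of lattice paths and their period matrices -/

/-- The product of the matrices `A = (2 1; 1 1)` (where `y` stays) and `B = (1 1; 1 2)` (where `y`
changes) along the first steps of a sequence `y`. -/
def wordProd (y : ℕ → ℕ) : ℕ → Matrix (Fin 2) (Fin 2) ℤ
  | 0 => 1
  | h + 1 => wordProd y h * (if y (h + 1) = y h then !![2, 1; 1, 1] else !![1, 1; 1, 2])

/-- A word depends only on the increments of `y`, so a window in which `y` is a translate of `y'`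
contributes the word of `y'`. -/
lemma wordProd_add {y y' : ℕ → ℕ} {a b c : ℕ} (H : ∀ h ≤ b, y (a + h) = c + y' h) :
    ∀ h ≤ b, wordProd y (a + h) = wordProd y a * wordProd y' h := by
  intro h
  induction h with
  | zero => intro _; simp [wordProd]
  | succ h ih =>
    intro hb
    have h1 := H h (by omega)
    have h2 : y (a + h + 1) = c + y' (h + 1) := H (h + 1) hb
    rw [← add_assoc, wordProd, wordProd, ih (by omega), h1, h2]
    simp [mul_assoc]

/-- The word of the lattice path below the line of direction `(m, n)`, as a matrix product. -/
def slopeWord (m n : ℕ) : ℕ → Matrix (Fin 2) (Fin 2) ℤ :=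
  wordProd fun h => n * h / (m + n)

/-- The matrix of one period of the lattice path of direction `(m, n)`. -/
def periodMatrix (m n : ℕ) : Matrix (Fin 2) (Fin 2) ℤ := slopeWord m n (m + n)

lemma slopeWord_mul_period (m n : ℕ) (hmn : 0 < m + n) (k : ℕ) :
    slopeWord m n (k * (m + n)) = periodMatrix m n ^ k := by
  induction k with
  | zero => simp [slopeWord, wordProd]
  | succ k ih =>
    have := wordProd_add (y := fun h => n * h / (m + n)) (y' := fun h => n * h / (m + n))
      (a := k * (m + n)) (b := m + n) (c := n * k) (by
        intro h _
        have : n * (k * (m + n) + h) = n * h + (m + n) * (n * k) := by ring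
        simp only [this, Nat.add_mul_div_left _ _ hmn]
        ring) (m + n) le_rfl
    rw [pow_succ, ← ih, add_mul, one_mul]
    exact this

/-- The path of the lower parent is a prefix of the path of the mediant. After multiplication by
`h₁` the determinant condition leaves the remainder `ρ (h₁ + h₂) + h`, with `ρ < h₁` and `h < h₁ +
h₂`, which is too small to change the quotient. -/
lemma floor_left {n₁ h₁ n₂ h₂ h : ℕ} (hdet : n₂ * h₁ = n₁ * h₂ + 1) (hh : h ≤ h₁) (h2 : 0 < h₂) :
    (n₁ + n₂) * h / (h₁ + h₂) = n₁ * h / h₁ := by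
  have h1 : 0 < h₁ := by
    rcases Nat.eq_zero_or_pos h₁ with h | h
    · subst h; omega
    · exact h
  have e := Nat.div_add_mod (n₁ * h) h₁
  have r := Nat.mod_lt (n₁ * h) h1
  set y := n₁ * h / h₁
  set ρ := n₁ * h % h₁
  have key : h₁ * ((n₁ + n₂) * h) = h₁ * (y * (h₁ + h₂)) + (ρ * (h₁ + h₂) + h) := by
    zify at *
    linear_combination h * hdet - (h₁ + h₂ : ℤ) * e
  apply Nat.div_eq_of_lt_le
  · apply Nat.le_of_mul_le_mul_left _ h1
    rw [key]; omega
  · apply Nat.lt_of_mul_lt_mul_left (a := h₁)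
    rw [key]
    have : (ρ + 1) * (h₁ + h₂) ≤ h₁ * (h₁ + h₂) := Nat.mul_le_mul_right _ r
    nlinarith

/-- The path of the upper parent is the matching suffix; here the remainder is `ρ (h₁ + h₂) + (h₂ -
h)`. -/
lemma floor_right {n₁ h₁ n₂ h₂ h : ℕ} (hdet : n₂ * h₁ = n₁ * h₂ + 1) (hh : h ≤ h₂) (h2 : 0 < h₂) :
    (n₁ + n₂) * (h₁ + h) / (h₁ + h₂) = n₁ + n₂ * h / h₂ := by
  have h1 : 0 < h₁ := by
    rcases Nat.eq_zero_or_pos h₁ with h | h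
    · subst h; omega
    · exact h
  have e := Nat.div_add_mod (n₂ * h) h₂
  have r := Nat.mod_lt (n₂ * h) h2
  set y := n₂ * h / h₂
  set ρ := n₂ * h % h₂
  have key : h₂ * ((n₁ + n₂) * (h₁ + h)) + h =
      h₂ * ((n₁ + y) * (h₁ + h₂)) + (ρ * (h₁ + h₂) + h₂) := by
    zify at *
    linear_combination (h₂ - h : ℤ) * hdet - (h₁ + h₂ : ℤ) * e
  apply Nat.div_eq_of_lt_le
  · apply Nat.le_of_mul_le_mul_left _ h2
    omega
  · apply Nat.lt_of_mul_lt_mul_left (a := h₂)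
    have : (ρ + 1) * (h₁ + h₂) ≤ h₂ * (h₁ + h₂) := Nat.mul_le_mul_right _ r
    nlinarith

/-- This is the standard factorization of a Christoffel word, lower parent first. -/
lemma periodMatrix_add {m₁ n₁ m₂ n₂ : ℕ} (hdet : m₁ * n₂ = n₁ * m₂ + 1) :
    periodMatrix (m₁ + m₂) (n₁ + n₂) = periodMatrix m₁ n₁ * periodMatrix m₂ n₂ := by
  have hd : n₂ * (m₁ + n₁) = n₁ * (m₂ + n₂) + 1 := by linarith
  have h2 : 0 < m₂ + n₂ := by
    rcases Nat.eq_zero_or_pos n₂ with h | h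
    · subst h; omega
    · omega
  have e : m₁ + m₂ + (n₁ + n₂) = m₁ + n₁ + (m₂ + n₂) := by ring
  have l := wordProd_add (y := fun h => (n₁ + n₂) * h / (m₁ + m₂ + (n₁ + n₂)))
    (y' := fun h => n₁ * h / (m₁ + n₁)) (a := 0) (b := m₁ + n₁) (c := 0) (by
      intro h hh
      simp only [e, zero_add]
      exact floor_left hd hh h2) (m₁ + n₁) le_rfl
  have r := wordProd_add (y := fun h => (n₁ + n₂) * h / (m₁ + m₂ + (n₁ + n₂)))
    (y' := fun h => n₂ * h / (m₂ + n₂)) (a := m₁ + n₁) (b := m₂ + n₂) (c := n₁) (by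
      intro h hh
      simp only [e]
      exact floor_right hd hh h2) (m₂ + n₂) le_rfl
  unfold periodMatrix slopeWord
  rw [e] at *
  rw [r]
  congr 1
  simpa [wordProd] using l

/-! ### Cohn matrices along the tree of Markov fractions -/

/-- The period matrix of direction `(m, n)` is the Cohn matrix of the fraction `P.1 / P.2`, and the
one of the mirrored direction is its mirror image. -/
def IsCohn (m n : ℕ) (P : ℤ × ℤ) : Prop :=
  ∃ c : ℤ, periodMatrix m n = !![2 * P.2 - P.1, c; P.2, P.1 + P.2] ∧
    periodMatrix n m = !![P.1 + P.2, c; P.2, 2 * P.2 - P.1] ∧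
    (2 * P.2 - P.1) * (P.1 + P.2) - c * P.2 = 1

/-- The relations between the two faces at an edge of the tree of Markov fractions. -/
structure MarkovPair (P Q : ℤ × ℤ) : Prop where
  pos_left : 0 < P.2
  pos_right : 0 < Q.2
  pos_det : 0 < Q.1 * P.2 - P.1 * Q.2
  markov : P.2 ^ 2 + Q.2 ^ 2 + (Q.1 * P.2 - P.1 * Q.2) ^ 2 =
    3 * P.2 * Q.2 * (Q.1 * P.2 - P.1 * Q.2)

/-- The two denominators and the determinant form a Markov triple; the child's denominator is the
other root in the Vieta jump that replaces the determinant. -/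
lemma MarkovPair.child_snd {P Q : ℤ × ℤ} (h : MarkovPair P Q) :
    (markovChild P Q).2 = 3 * P.2 * Q.2 - (Q.1 * P.2 - P.1 * Q.2) := by
  apply Int.ediv_eq_of_eq_mul_right h.pos_det.ne'
  linear_combination h.markov

/-- The first two summands are the lower right entry of the product of the parents' Cohn matrices,
which has to equal numerator plus denominator of the child. -/
lemma MarkovPair.child_fst {P Q : ℤ × ℤ} (h : MarkovPair P Q) {c : ℤ}
    (hc : (2 * Q.2 - Q.1) * (Q.1 + Q.2) - c * Q.2 = 1) :
    (markovChild P Q).1 = P.2 * c + (P.1 + P.2) * (Q.1 + Q.2) -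
      (3 * P.2 * Q.2 - (Q.1 * P.2 - P.1 * Q.2)) := by
  apply Int.ediv_eq_of_eq_mul_right h.pos_det.ne'
  apply mul_left_cancel₀ h.pos_right.ne'
  linear_combination (Q.1 * P.2 - P.1 * Q.2) * P.2 * hc + Q.1 * h.markov

lemma MarkovPair.isCohn_child {P Q : ℤ × ℤ} (h : MarkovPair P Q) {m₁ n₁ m₂ n₂ : ℕ}
    (hdet : m₁ * n₂ = n₁ * m₂ + 1) (hP : IsCohn m₁ n₁ P) (hQ : IsCohn m₂ n₂ Q) :
    IsCohn (m₁ + m₂) (n₁ + n₂) (markovChild P Q) := by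
  obtain ⟨c, hP1, hP2, hP3⟩ := hP
  obtain ⟨d, hQ1, hQ2, hQ3⟩ := hQ
  have e1 := periodMatrix_add hdet
  -- Mirroring turns the upper parent into the lower one, so the factors come in the opposite order.
  have e2 := periodMatrix_add (m₁ := n₂) (n₁ := m₂) (m₂ := n₁) (n₂ := m₁) (by linarith)
  have f1 := h.child_fst hQ3
  have f2 := h.child_snd
  -- The trace of the product is three times the child's denominator; once multiplied by both parent
  -- denominators, this follows from the determinants and the Markov equation.
  have f3 : (2 * P.2 - P.1) * (2 * Q.2 - Q.1) + c * Q.2 + (P.2 * d + (P.1 + P.2) * (Q.1 + Q.2)) =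
      3 * (3 * P.2 * Q.2 - (Q.1 * P.2 - P.1 * Q.2)) := by
    apply mul_left_cancel₀ (mul_pos h.pos_left h.pos_right).ne'
    linear_combination -(Q.2 ^ 2) * hP3 - P.2 ^ 2 * hQ3 - h.markov
  refine ⟨(2 * P.2 - P.1) * d + c * (Q.1 + Q.2), ?_, ?_, ?_⟩
  · rw [e1, hP1, hQ1, Matrix.mul_fin_two, f1, f2]
    congrm !![?_, ?_; ?_, ?_]
    · linear_combination f3
    · ring
    · ring
    · ring
  · rw [add_comm n₁, add_comm m₁, e2, hP2, hQ2, Matrix.mul_fin_two, f1, f2]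
    congrm !![?_, ?_; ?_, ?_]
    · ring
    · ring
    · ring
    · linear_combination f3
  · rw [f1, f2]
    linear_combination ((2 * Q.2 - Q.1) * (Q.1 + Q.2) - d * Q.2) * hP3 + hQ3 -
      (P.2 * d + (P.1 + P.2) * (Q.1 + Q.2)) * f3

/-- The determinant of `P` and the child is the denominator of `Q`, so the new pair carries the
triple obtained by the Vieta jump. -/
lemma MarkovPair.lower {P Q : ℤ × ℤ} (h : MarkovPair P Q) {c : ℤ}
    (hc : (2 * Q.2 - Q.1) * (Q.1 + Q.2) - c * Q.2 = 1) : MarkovPair P (markovChild P Q) := by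
  have f1 := h.child_fst hc
  have f2 := h.child_snd
  have f3 : (markovChild P Q).1 * P.2 - P.1 * (markovChild P Q).2 = Q.2 := by
    apply mul_left_cancel₀ (mul_pos h.pos_det h.pos_right).ne'
    rw [f1, f2]
    linear_combination
      -P.2 * (Q.1 * P.2 - P.1 * Q.2) * P.2 * hc - (Q.1 * P.2 - P.1 * Q.2) * h.markov
  refine ⟨h.pos_left, ?_, ?_, ?_⟩
  · have := h.markov
    have := h.pos_left
    have := h.pos_right
    have := h.pos_det
    rw [f2]
    nlinarith [sq_nonneg P.2]
  · rw [f3]; exact h.pos_right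
  · rw [f3, f2]
    linear_combination h.markov

/-- Same triple; now the determinant is the denominator of `P`. -/
lemma MarkovPair.upper {P Q : ℤ × ℤ} (h : MarkovPair P Q) {c : ℤ}
    (hc : (2 * Q.2 - Q.1) * (Q.1 + Q.2) - c * Q.2 = 1) : MarkovPair (markovChild P Q) Q := by
  have f1 := h.child_fst hc
  have f2 := h.child_snd
  have f3 : Q.1 * (markovChild P Q).2 - (markovChild P Q).1 * Q.2 = P.2 := by
    apply mul_left_cancel₀ h.pos_det.ne'
    rw [f1, f2]
    linear_combination (Q.1 * P.2 - P.1 * Q.2) * P.2 * hc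
  refine ⟨?_, h.pos_right, ?_, ?_⟩
  · exact (h.lower hc).pos_right
  · rw [f3]; exact h.pos_left
  · rw [f3, f2]
    linear_combination h.markov

/-- The three invariants go together: the Cohn matrix of `Q` supplies the determinant relation
needed to pass Markov pairs on, and the unimodularity of the indices the factorization of words. -/
lemma TreeEdge.spec {a b : ℕ × ℕ} {P Q : ℤ × ℤ} (h : TreeEdge a b P Q) :
    a.2 * b.1 = a.1 * b.2 + 1 ∧ MarkovPair P Q ∧ IsCohn a.2 a.1 P ∧ IsCohn b.2 b.1 Q := by
  induction h with
  | root =>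
    refine ⟨rfl, ⟨by norm_num, by norm_num, by norm_num, by norm_num⟩, ⟨1, ?_⟩, ⟨1, ?_⟩⟩ <;>
    simp [periodMatrix, slopeWord, wordProd]
  | @lower a b P Q _ ih =>
    obtain ⟨h1, h2, h3, h4⟩ := ih
    refine ⟨?_, h2.lower h4.choose_spec.2.2, h3, h2.isCohn_child h1 h3 h4⟩
    simp only [Prod.fst_add, Prod.snd_add]
    linarith
  | @upper a b P Q _ ih =>
    obtain ⟨h1, h2, h3, h4⟩ := ih
    refine ⟨?_, h2.upper h4.choose_spec.2.2, h2.isCohn_child h1 h3 h4, h4⟩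
    simp only [Prod.fst_add, Prod.snd_add]
    linarith

lemma IsMarkovFractionAt.spec {m n : ℕ} {p q : ℤ} (h : IsMarkovFractionAt n m p q) :
    0 < q ∧ IsCohn m n (p, q) := by
  rcases h with ⟨b, Q, h⟩ | ⟨a, P, h⟩
  · exact ⟨h.spec.2.1.pos_left, h.spec.2.2.1⟩
  · exact ⟨h.spec.2.1.pos_right, h.spec.2.2.2⟩

/-! ### Powers of Cohn matrices -/

lemma companionSeq_mono {q : ℤ} (hq : 0 < q) (k : ℕ) :
    0 ≤ companionSeq q k ∧ companionSeq q k < companionSeq q (k + 1) := by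
  induction k with
  | zero => simp [companionSeq]
  | succ k ih =>
    refine ⟨by omega, ?_⟩
    rw [companionSeq]
    nlinarith [ih.1, ih.2]

/-- The powers of a `2 × 2` matrix of determinant `1` and trace `3 q`. -/
lemma pow_eq_companionSeq {q a b c d : ℤ} (htr : a + d = 3 * q) (hdet : a * d - b * c = 1) (k : ℕ) :
    !![a, b; c, d] ^ (k + 1) =
      !![companionSeq q (k + 1) * a - companionSeq q k, companionSeq q (k + 1) * b;
        companionSeq q (k + 1) * c, companionSeq q (k + 1) * d - companionSeq q k] := by
  induction k with
  | zero => simp [companionSeq]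
  | succ k ih =>
    -- Cayley–Hamilton, `M² = 3q M - 1`, entry by entry.
    rw [pow_succ, ih, Matrix.mul_fin_two, companionSeq]
    congrm !![?_, ?_; ?_, ?_]
    · linear_combination companionSeq q (k + 1) * (a * htr - hdet)
    · linear_combination companionSeq q (k + 1) * b * htr
    · linear_combination companionSeq q (k + 1) * c * htr
    · linear_combination companionSeq q (k + 1) * (d * htr - hdet)

/-! ### Lattice triangles in coordinates -/

/-- The point `x + y ω` of the plane. -/
noncomputable def planePoint (x y : ℝ) : ℂ := (x : ℂ) + (y : ℂ) * eisOmega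

lemma planePoint_inj {x y x' y' : ℝ} : planePoint x y = planePoint x' y' ↔ x = x' ∧ y = y' := by
  constructor
  · intro h
    have hre := congrArg Complex.re h
    have him := congrArg Complex.im h
    simp [planePoint, eisOmega] at hre him
    subst him
    exact ⟨by linarith, rfl⟩
  · rintro ⟨rfl, rfl⟩
    rfl

lemma eisPoint_eq (v : ℤ × ℤ) : eisPoint v = planePoint v.1 v.2 := by
  simp [eisPoint, planePoint]

lemma eisPoint_injective : Function.Injective eisPoint := by
  intro v w h
  rw [eisPoint_eq, eisPoint_eq, planePoint_inj] at h
  exact Prod.ext (by exact_mod_cast h.1) (by exact_mod_cast h.2)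

/-- The closed triangle spanned by `T`, in coordinates. -/
def InTri (T : Finset (ℤ × ℤ)) (x y : ℝ) : Prop :=
  ∃ f : ℤ × ℤ → ℝ, (∀ v ∈ T, 0 ≤ f v) ∧ ∑ v ∈ T, f v = 1 ∧
    ∑ v ∈ T, f v * v.1 = x ∧ ∑ v ∈ T, f v * v.2 = y

lemma mem_eisRegion_iff {T : Finset (ℤ × ℤ)} {x y : ℝ} :
    planePoint x y ∈ eisRegion T ↔ InTri T x y := by
  classical
  have sum_eq : ∀ f : ℤ × ℤ → ℝ, ∑ v ∈ T, f v • eisPoint v =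
      planePoint (∑ v ∈ T, f v * v.1) (∑ v ∈ T, f v * v.2) := by
    intro f
    simp only [planePoint, Complex.ofReal_sum, Finset.sum_mul, ← Finset.sum_add_distrib]
    refine Finset.sum_congr rfl fun v _ => ?_
    simp [eisPoint]
    ring
  unfold eisRegion
  rw [← Finset.coe_image, Finset.mem_convexHull']
  constructor
  · rintro ⟨g, hg, hs, hx⟩
    rw [Finset.sum_image fun _ _ _ _ h => eisPoint_injective h] at hs hx
    rw [sum_eq (fun v => g (eisPoint v)), planePoint_inj] at hx
    exact ⟨fun v => g (eisPoint v), fun v hv => hg _ (Finset.mem_image_of_mem _ hv), hs, hx⟩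
  · rintro ⟨f, hf, hs, hx⟩
    -- Weights indexed by lattice coordinates become weights on points of the plane.
    have e : ∀ v, f (Function.invFun eisPoint (eisPoint v)) = f v := fun v => by
      rw [Function.leftInverse_invFun eisPoint_injective v]
    refine ⟨fun z => f (Function.invFun eisPoint z), ?_, ?_, ?_⟩
    · intro z hz
      obtain ⟨v, hv, rfl⟩ := Finset.mem_image.1 hz
      simpa only [e] using hf v hv
    · rw [Finset.sum_image fun _ _ _ _ h => eisPoint_injective h]
      simpa only [e] using hs
    · rw [Finset.sum_image fun _ _ _ _ h => eisPoint_injective h]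
      simp only [e]
      rw [sum_eq, hx.1, hx.2]

/-- The lattice triangle with corner `w` and sides `σ`, `σ ω` at this corner. -/
def tri (w : ℤ × ℤ) (σ : ℤ) : Finset (ℤ × ℤ) := {w, (w.1 + σ, w.2), (w.1, w.2 + σ)}

/-- A corner and a sign describe both orientations at once, so that one set of inequalities serves
for both. -/
lemma isEisTriangle_iff {T : Finset (ℤ × ℤ)} :
    IsEisTriangle T ↔ ∃ w σ, (σ = 1 ∨ σ = -1) ∧ T = tri w σ := by
  constructor
  · rintro ⟨v, rfl | rfl⟩
    · exact ⟨v, 1, Or.inl rfl, by ext; simp [tri, Prod.ext_iff]⟩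
    · refine ⟨v + (1, 1), -1, Or.inr rfl, ?_⟩
      ext
      simp [tri, Prod.ext_iff]
      tauto
  · rintro ⟨w, σ, rfl | rfl, rfl⟩
    · exact ⟨w, Or.inl (by ext; simp [tri, Prod.ext_iff])⟩
    · refine ⟨w - (1, 1), Or.inr ?_⟩
      ext
      simp [tri, Prod.ext_iff, sub_eq_add_neg]
      tauto

lemma sum_tri {M : Type*} [AddCommMonoid M] {w : ℤ × ℤ} {σ : ℤ} (hσ : σ = 1 ∨ σ = -1)
    (f : ℤ × ℤ → M) :
    ∑ v ∈ tri w σ, f v = f w + f (w.1 + σ, w.2) + f (w.1, w.2 + σ) := by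
  have h0 : σ ≠ 0 := by omega
  rw [tri, Finset.sum_insert, Finset.sum_insert, Finset.sum_singleton, add_assoc]
  · simp [h0]
  · simp [Prod.ext_iff, h0]

/-- The two products are the barycentric weights at the corners other than `w`. -/
lemma inTri_tri {w : ℤ × ℤ} {σ : ℤ} (hσ : σ = 1 ∨ σ = -1) {x y : ℝ} :
    InTri (tri w σ) x y ↔ 0 ≤ σ * (x - w.1) ∧ 0 ≤ σ * (y - w.2) ∧
      σ * (x - w.1) + σ * (y - w.2) ≤ 1 := by
  have h0 : σ ≠ 0 := by omega
  have h1 : (σ : ℝ) * σ = 1 := by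
    rcases hσ with rfl | rfl <;> norm_num
  constructor
  · rintro ⟨f, hf, hs, hx, hy⟩
    rw [sum_tri hσ] at hs hx hy
    have a := hf w (by simp [tri])
    have b := hf (w.1 + σ, w.2) (by simp [tri])
    have c := hf (w.1, w.2 + σ) (by simp [tri])
    push_cast at hx hy
    have ex : (σ : ℝ) * (x - w.1) = f (w.1 + σ, w.2) := by
      linear_combination -(σ : ℝ) * hx + σ * w.1 * hs + f (w.1 + σ, w.2) * h1
    have ey : (σ : ℝ) * (y - w.2) = f (w.1, w.2 + σ) := by
      linear_combination -(σ : ℝ) * hy + σ * w.2 * hs + f (w.1, w.2 + σ) * h1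
    rw [ex, ey]
    exact ⟨b, c, by linarith⟩
  · rintro ⟨hx, hy, hxy⟩
    refine ⟨fun v => if v = w then 1 - σ * (x - w.1) - σ * (y - w.2) else
      if v = (w.1 + σ, w.2) then σ * (x - w.1) else σ * (y - w.2), ?_, ?_, ?_, ?_⟩
    · intro v _
      dsimp only
      split_ifs <;> linarith
    all_goals
      rw [sum_tri hσ]
      simp only [Prod.ext_iff, if_true, and_self, add_eq_left, h0, and_true, and_false, if_false,
        left_eq_add]
      push_cast
    · ring
    · linear_combination (x - w.1) * h1
    · linear_combination (y - w.2) * h1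

/-- The open triangle spanned by `T`, in coordinates. -/
def InOpenTri (T : Finset (ℤ × ℤ)) (x y : ℝ) : Prop :=
  ∃ f : ℤ × ℤ → ℝ, (∀ v ∈ T, 0 < f v) ∧ ∑ v ∈ T, f v = 1 ∧
    ∑ v ∈ T, f v * v.1 = x ∧ ∑ v ∈ T, f v * v.2 = y

lemma InOpenTri.ineq {w : ℤ × ℤ} {σ : ℤ} (hσ : σ = 1 ∨ σ = -1) {x y : ℝ}
    (h : InOpenTri (tri w σ) x y) : 0 < σ * (x - w.1) ∧ 0 < σ * (y - w.2) ∧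
      σ * (x - w.1) + σ * (y - w.2) < 1 := by
  have h1 : (σ : ℝ) * σ = 1 := by
    rcases hσ with rfl | rfl <;> norm_num
  obtain ⟨f, hf, hs, hx, hy⟩ := h
  rw [sum_tri hσ] at hs hx hy
  have a := hf w (by simp [tri])
  have b := hf (w.1 + σ, w.2) (by simp [tri])
  have c := hf (w.1, w.2 + σ) (by simp [tri])
  push_cast at hx hy
  have ex : (σ : ℝ) * (x - w.1) = f (w.1 + σ, w.2) := by
    linear_combination -(σ : ℝ) * hx + σ * w.1 * hs + f (w.1 + σ, w.2) * h1
  have ey : (σ : ℝ) * (y - w.2) = f (w.1, w.2 + σ) := by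
    linear_combination -(σ : ℝ) * hy + σ * w.2 * hs + f (w.1, w.2 + σ) * h1
  rw [ex, ey]
  exact ⟨b, c, by linarith⟩

/-- A point in the open triangle lies in no other closed triangle. -/
lemma tri_unique {w w' : ℤ × ℤ} {σ σ' : ℤ} (hσ : σ = 1 ∨ σ = -1) (hσ' : σ' = 1 ∨ σ' = -1)
    {x y : ℝ} (h : 0 < σ * (x - w.1) ∧ 0 < σ * (y - w.2) ∧
      σ * (x - w.1) + σ * (y - w.2) < 1)
    (h' : 0 ≤ σ' * (x - w'.1) ∧ 0 ≤ σ' * (y - w'.2) ∧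
      σ' * (x - w'.1) + σ' * (y - w'.2) ≤ 1) : w = w' ∧ σ = σ' := by
  obtain ⟨a, b⟩ := w
  obtain ⟨c, d⟩ := w'
  obtain ⟨h1, h2, h3⟩ := h
  obtain ⟨h4, h5, h6⟩ := h'
  have key : ∀ {i j : ℤ}, (i : ℝ) < j → i < j := fun h => by exact_mod_cast h
  rcases hσ with rfl | rfl <;> rcases hσ' with rfl | rfl <;> push_cast at *
  · have k1 : c < a + 1 := key (by push_cast; linarith)
    have k2 : d < b + 1 := key (by push_cast; linarith)
    have k3 : a + b < c + d + 1 := key (by push_cast; linarith)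
    refine ⟨Prod.ext ?_ ?_, ?_⟩ <;> (try dsimp only) <;> omega
  · have k1 : a < c := key (by linarith)
    have k2 : b < d := key (by linarith)
    have k3 : c + d - 1 < a + b + 1 := key (by push_cast; linarith)
    refine ⟨Prod.ext ?_ ?_, ?_⟩ <;> (try dsimp only) <;> omega
  · have k1 : c < a := key (by linarith)
    have k2 : d < b := key (by linarith)
    have k3 : a + b - 1 < c + d + 1 := key (by push_cast; linarith)
    refine ⟨Prod.ext ?_ ?_, ?_⟩ <;> (try dsimp only) <;> omega
  · have k1 : a < c + 1 := key (by push_cast; linarith)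
    have k2 : b < d + 1 := key (by push_cast; linarith)
    have k3 : c + d - 1 < a + b := key (by push_cast; linarith)
    refine ⟨Prod.ext ?_ ?_, ?_⟩ <;> (try dsimp only) <;> omega

lemma InOpenTri.eq {T T' : Finset (ℤ × ℤ)} (hT : IsEisTriangle T) (hT' : IsEisTriangle T')
    {x y : ℝ} (h : InOpenTri T x y) (h' : InTri T' x y) : T = T' := by
  obtain ⟨w, σ, hσ, rfl⟩ := isEisTriangle_iff.1 hT
  obtain ⟨w', σ', hσ', rfl⟩ := isEisTriangle_iff.1 hT'
  obtain ⟨rfl, rfl⟩ := tri_unique hσ hσ' (h.ineq hσ) ((inTri_tri hσ').1 h')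
  rfl

lemma mem_of_inTri {T : Finset (ℤ × ℤ)} (hT : IsEisTriangle T) {v : ℤ × ℤ}
    (h : InTri T v.1 v.2) : v ∈ T := by
  obtain ⟨w, σ, hσ, rfl⟩ := isEisTriangle_iff.1 hT
  obtain ⟨h1, h2, h3⟩ := (inTri_tri hσ).1 h
  obtain ⟨a, b⟩ := v
  obtain ⟨c, d⟩ := w
  norm_cast at h1 h2 h3
  simp only [tri, Finset.mem_insert, Finset.mem_singleton, Prod.mk.injEq]
  rcases hσ with rfl | rfl <;> omega

/-! ### Triangles with a common edge -/

/-- Two triangles on the two sides of the edge `A B`, with a common point `(x, y)` inside this edge. -/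
structure SharedEdge (T T' : Finset (ℤ × ℤ)) (x y : ℝ) (A B U : ℤ × ℤ) : Prop where
  left_eq : T = {A, B, U}
  right_eq : T' = {A, B, A + B - U}
  det : (B.1 - A.1) * (U.2 - A.2) - (B.2 - A.2) * (U.1 - A.1) = 1 ∨
    (B.1 - A.1) * (U.2 - A.2) - (B.2 - A.2) * (U.1 - A.1) = -1
  mem : ∃ μ : ℝ, 0 < μ ∧ μ < 1 ∧ x = A.1 + μ * (B.1 - A.1) ∧ y = A.2 + μ * (B.2 - A.2)

lemma SharedEdge.symm {T T' : Finset (ℤ × ℤ)} {x y : ℝ} {A B U : ℤ × ℤ}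
    (h : SharedEdge T T' x y A B U) : SharedEdge T T' x y B A U := by
  obtain ⟨h1, h2, h3, μ, h4, h5, h6, h7⟩ := h
  refine ⟨?_, ?_, ?_, 1 - μ, by linarith, by linarith, by linarith, by linarith⟩
  · rw [h1, Finset.insert_comm]
  · rw [h2, Finset.insert_comm, add_comm]
  · rcases h3 with h3 | h3
    · right; linear_combination -h3
    · left; linear_combination -h3

/-- A point inside one side of a triangle lies in just one other triangle, since strict real
inequalities between integers can be rounded. This and the next two lemmas treat the three sides. -/
lemma tri_across_left {a b c d σ σ' : ℤ} (hσ : σ = 1 ∨ σ = -1)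
    (hσ' : σ' = 1 ∨ σ' = -1) (hne : a ≠ c ∨ b ≠ d ∨ σ ≠ σ') {x y : ℝ}
    (e : x = a) (l : 0 < σ * (y - b)) (l' : σ * (y - b) < 1)
    (h4 : 0 ≤ σ' * (x - c)) (h5 : 0 ≤ σ' * (y - d)) (h6 : σ' * (x - c) + σ' * (y - d) ≤ 1) :
    c = a ∧ d = b + σ ∧ σ' = -σ := by
  have key : ∀ {i j : ℤ}, (i : ℝ) < j → i < j := fun h => by exact_mod_cast h
  rcases hσ with rfl | rfl <;> rcases hσ' with rfl | rfl <;>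
    simp only [Int.cast_one, Int.cast_neg, neg_mul, one_mul] at e l l' h4 h5 h6
  · have k1 : c < a + 1 := key (by push_cast; linarith)
    have k2 : d < b + 1 := key (by push_cast; linarith)
    have k3 : a + b < c + d + 1 := key (by push_cast; linarith)
    omega
  · have k1 : a < c + 1 := key (by push_cast; linarith)
    have k2 : b < d := key (by linarith)
    have k3 : c + d - 1 < a + b + 1 := key (by push_cast; linarith)
    omega
  · have k1 : c < a + 1 := key (by push_cast; linarith)
    have k2 : d < b := key (by linarith)
    have k3 : a + b - 1 < c + d + 1 := key (by push_cast; linarith)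
    omega
  · have k1 : a < c + 1 := key (by push_cast; linarith)
    have k2 : b < d + 1 := key (by push_cast; linarith)
    have k3 : c + d - 1 < a + b := key (by push_cast; linarith)
    omega

lemma tri_across_bottom {a b c d σ σ' : ℤ} (hσ : σ = 1 ∨ σ = -1)
    (hσ' : σ' = 1 ∨ σ' = -1) (hne : a ≠ c ∨ b ≠ d ∨ σ ≠ σ') {x y : ℝ}
    (e : y = b) (l : 0 < σ * (x - a)) (l' : σ * (x - a) < 1)
    (h4 : 0 ≤ σ' * (x - c)) (h5 : 0 ≤ σ' * (y - d)) (h6 : σ' * (x - c) + σ' * (y - d) ≤ 1) :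
    c = a + σ ∧ d = b ∧ σ' = -σ := by
  have key : ∀ {i j : ℤ}, (i : ℝ) < j → i < j := fun h => by exact_mod_cast h
  rcases hσ with rfl | rfl <;> rcases hσ' with rfl | rfl <;>
    simp only [Int.cast_one, Int.cast_neg, neg_mul, one_mul] at e l l' h4 h5 h6
  · have k1 : c < a + 1 := key (by push_cast; linarith)
    have k2 : d < b + 1 := key (by push_cast; linarith)
    have k3 : a + b < c + d + 1 := key (by push_cast; linarith)
    omega
  · have k1 : a < c := key (by linarith)
    have k2 : b < d + 1 := key (by push_cast; linarith)
    have k3 : c + d - 1 < a + b + 1 := key (by push_cast; linarith)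
    omega
  · have k1 : c < a := key (by linarith)
    have k2 : d < b + 1 := key (by push_cast; linarith)
    have k3 : a + b - 1 < c + d + 1 := key (by push_cast; linarith)
    omega
  · have k1 : a < c + 1 := key (by push_cast; linarith)
    have k2 : b < d + 1 := key (by push_cast; linarith)
    have k3 : c + d - 1 < a + b := key (by push_cast; linarith)
    omega

lemma tri_across_diagonal {a b c d σ σ' : ℤ} (hσ : σ = 1 ∨ σ = -1)
    (hσ' : σ' = 1 ∨ σ' = -1) (hne : a ≠ c ∨ b ≠ d ∨ σ ≠ σ') {x y : ℝ}
    (e : 1 = σ * (x - a) + σ * (y - b)) (l : 0 < σ * (x - a)) (l' : 0 < σ * (y - b))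
    (h4 : 0 ≤ σ' * (x - c)) (h5 : 0 ≤ σ' * (y - d)) (h6 : σ' * (x - c) + σ' * (y - d) ≤ 1) :
    c = a + σ ∧ d = b + σ ∧ σ' = -σ := by
  have key : ∀ {i j : ℤ}, (i : ℝ) < j → i < j := fun h => by exact_mod_cast h
  rcases hσ with rfl | rfl <;> rcases hσ' with rfl | rfl <;>
    simp only [Int.cast_one, Int.cast_neg, neg_mul, one_mul] at e l l' h4 h5 h6
  · have k1 : c < a + 1 := key (by push_cast; linarith)
    have k2 : d < b + 1 := key (by push_cast; linarith)
    have k3 : a + b < c + d + 1 := key (by push_cast; linarith)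
    omega
  · have k1 : a < c := key (by linarith)
    have k2 : b < d := key (by linarith)
    have k3 : c + d - 1 < a + b + 2 := key (by push_cast; linarith)
    omega
  · have k1 : c < a := key (by linarith)
    have k2 : d < b := key (by linarith)
    have k3 : a + b - 2 < c + d + 1 := key (by push_cast; linarith)
    omega
  · have k1 : a < c + 1 := key (by push_cast; linarith)
    have k2 : b < d + 1 := key (by push_cast; linarith)
    have k3 : c + d - 1 < a + b := key (by push_cast; linarith)
    omega

lemma triple_rotate {α : Type*} [DecidableEq α] (a b c : α) : ({a, b, c} : Finset α) = {c, a, b} := by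
  rw [Finset.pair_comm, Finset.insert_comm]

/-- A common point cannot be in the open triangle `T`, because closed triangles meet open ones only
in themselves. It is not a corner, so it lies inside one of the three sides. -/
lemma exists_sharedEdge {T T' : Finset (ℤ × ℤ)} (hT : IsEisTriangle T) (hT' : IsEisTriangle T')
    (hne : T ≠ T') {x y : ℝ} (h : InTri T x y) (h' : InTri T' x y)
    (hxy : ∀ v : ℤ × ℤ, ¬(x = v.1 ∧ y = v.2)) : ∃ A B U, SharedEdge T T' x y A B U := by
  obtain ⟨w, σ, hσ, rfl⟩ := isEisTriangle_iff.1 hT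
  obtain ⟨w', σ', hσ', rfl⟩ := isEisTriangle_iff.1 hT'
  rw [inTri_tri hσ] at h
  rw [inTri_tri hσ'] at h'
  obtain ⟨a, b⟩ := w
  obtain ⟨c, d⟩ := w'
  obtain ⟨h1, h2, h3⟩ := h
  have hss : (σ : ℝ) * σ = 1 := by
    rcases hσ with rfl | rfl <;> norm_num
  have hne' : a ≠ c ∨ b ≠ d ∨ σ ≠ σ' := by
    by_contra! hcon
    obtain ⟨rfl, rfl, rfl⟩ := hcon
    exact hne rfl
  have n1 := hxy (a, b)
  have n2 := hxy (a + σ, b)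
  have n3 := hxy (a, b + σ)
  obtain ⟨h4, h5, h6⟩ := h'
  dsimp only at *
  rcases h1.eq_or_lt with e1 | l1
  · have ex : x = a := by linear_combination -(σ : ℝ) * e1 - (x - a) * hss
    subst ex
    have l2 : 0 < (σ : ℝ) * (y - b) := lt_of_le_of_ne h2 fun h =>
      n1 ⟨rfl, by linear_combination -(σ : ℝ) * h - (y - b) * hss⟩
    have l3 : (σ : ℝ) * (y - b) < 1 := lt_of_le_of_ne (by linarith) fun h =>
      n3 ⟨rfl, by push_cast; linear_combination (σ : ℝ) * h - (y - b) * hss⟩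
    have : c = a ∧ d = b + σ ∧ σ' = -σ :=
      tri_across_left hσ hσ' hne' rfl l2 l3 h4 h5 h6
    obtain ⟨rfl, rfl, rfl⟩ := this
    refine ⟨(c, b), (c, b + σ), (c + σ, b), ?_, ?_, ?_, σ * (y - b), l2, l3, ?_, ?_⟩
    · rw [tri, Finset.pair_comm]
    · have e1 : c + c - (c + σ) = c + -σ := by ring
      have e2 : b + (b + σ) - b = b + σ := by ring
      simp only [tri, add_neg_cancel_right, Prod.mk_add_mk, Prod.mk_sub_mk, e1, e2]
      exact triple_rotate _ _ _
    · simp only; rcases hσ with rfl | rfl <;> simp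
    · push_cast; ring
    · push_cast; linear_combination -(y - b) * hss
  rcases h2.eq_or_lt with e2 | l2
  · have ey : y = b := by linear_combination -(σ : ℝ) * e2 - (y - b) * hss
    subst ey
    have l3 : (σ : ℝ) * (x - a) < 1 := lt_of_le_of_ne (by linarith) fun h =>
      n2 ⟨by push_cast; linear_combination (σ : ℝ) * h - (x - a) * hss, rfl⟩
    have : c = a + σ ∧ d = b ∧ σ' = -σ :=
      tri_across_bottom hσ hσ' hne' rfl l1 l3 h4 h5 h6
    obtain ⟨rfl, rfl, rfl⟩ := this
    refine ⟨(a, d), (a + σ, d), (a, d + σ), ?_, ?_, ?_, σ * (x - a), l1, l3, ?_, ?_⟩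
    · rfl
    · have e1 : a + (a + σ) - a = a + σ := by ring
      have e2 : d + d - (d + σ) = d + -σ := by ring
      simp only [tri, add_neg_cancel_right, Prod.mk_add_mk, Prod.mk_sub_mk, e1, e2]
      rw [Finset.insert_comm]
    · simp only; rcases hσ with rfl | rfl <;> simp
    · push_cast; linear_combination -(x - a) * hss
    · push_cast; ring
  rcases h3.eq_or_lt with e3 | l3
  · have : c = a + σ ∧ d = b + σ ∧ σ' = -σ :=
      tri_across_diagonal hσ hσ' hne' e3.symm l1 l2 h4 h5 h6
    obtain ⟨rfl, rfl, rfl⟩ := this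
    refine ⟨(a + σ, b), (a, b + σ), (a, b), ?_, ?_, ?_, σ * (y - b), l2, by linarith, ?_, ?_⟩
    · rw [tri, triple_rotate, triple_rotate]
    · have e1 : a + σ + a - a = a + σ := by ring
      have e2 : b + (b + σ) - b = b + σ := by ring
      simp only [tri, add_neg_cancel_right, Prod.mk_add_mk, Prod.mk_sub_mk, e1, e2]
      rw [triple_rotate, Finset.pair_comm]
    · simp only; rcases hσ with rfl | rfl <;> simp
    · push_cast; linear_combination σ * e3 - (x - a) * hss
    · push_cast; linear_combination -(y - b) * hss
  · obtain ⟨h7, h8⟩ := tri_unique (w := (a, b)) (w' := (c, d)) hσ hσ' ⟨l1, l2, l3⟩ ⟨h4, h5, h6⟩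
    simp only [Prod.mk.injEq] at h7
    omega

/-! ### The strip of triangles along a ray -/

/-- The determinant of `(m, n)` and `v`: positive to the left of the line of direction `(m, n)`. -/
def slopeForm (m n : ℕ) (v : ℤ × ℤ) : ℤ := m * v.2 - n * v.1

/-- A triangle `w u v` of a strip of triangles along a line, entered through the edge `w u`, with
labels `lw`, `lu` at the vertices of this edge. -/
structure StripState where
  w : ℤ × ℤ
  u : ℤ × ℤ
  v : ℤ × ℤ
  lw : ℤ × ℤ
  lu : ℤ × ℤ

/-- The triangle of a strip state. -/
def StripState.tri (S : StripState) : Finset (ℤ × ℤ) := {S.w, S.u, S.v}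

/-- The label of the new vertex of a strip state. -/
def StripState.lv (S : StripState) : ℤ × ℤ := S.lw + S.lu

/-- The strip of triangles along the left side of the ray of direction `(m, n)` from `0`. -/
def strip (m n : ℕ) (l₀ lₐ : ℤ × ℤ) : ℕ → StripState
  -- The label at `ω - 1` is chosen so that the first new vertex, `ω`, gets `lₐ`.
  | 0 => ⟨(0, 0), (-1, 1), (0, 1), l₀, lₐ - l₀⟩
  | j + 1 =>
    if 0 < slopeForm m n (strip m n l₀ lₐ j).v then
      ⟨(strip m n l₀ lₐ j).w, (strip m n l₀ lₐ j).v,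
        (strip m n l₀ lₐ j).w + (strip m n l₀ lₐ j).v - (strip m n l₀ lₐ j).u,
        (strip m n l₀ lₐ j).lw, (strip m n l₀ lₐ j).lv⟩
    else
      ⟨(strip m n l₀ lₐ j).v, (strip m n l₀ lₐ j).u,
        (strip m n l₀ lₐ j).v + (strip m n l₀ lₐ j).u - (strip m n l₀ lₐ j).w,
        (strip m n l₀ lₐ j).lv, (strip m n l₀ lₐ j).lu⟩

section strip

variable {m n : ℕ} {l₀ lₐ : ℤ × ℤ}

lemma strip_succ_pos {j : ℕ} (h : 0 < slopeForm m n (strip m n l₀ lₐ j).v) :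
    strip m n l₀ lₐ (j + 1) = ⟨(strip m n l₀ lₐ j).w, (strip m n l₀ lₐ j).v,
        (strip m n l₀ lₐ j).w + (strip m n l₀ lₐ j).v - (strip m n l₀ lₐ j).u,
        (strip m n l₀ lₐ j).lw, (strip m n l₀ lₐ j).lv⟩ := by
  rw [strip, if_pos h]

lemma strip_succ_nonpos {j : ℕ} (h : ¬ 0 < slopeForm m n (strip m n l₀ lₐ j).v) :
    strip m n l₀ lₐ (j + 1) = ⟨(strip m n l₀ lₐ j).v, (strip m n l₀ lₐ j).u,
        (strip m n l₀ lₐ j).v + (strip m n l₀ lₐ j).u - (strip m n l₀ lₐ j).w,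
        (strip m n l₀ lₐ j).lv, (strip m n l₀ lₐ j).lu⟩ := by
  rw [strip, if_neg h]

lemma strip_types (hmn : 0 < m + n) (j : ℕ) : slopeForm m n (strip m n l₀ lₐ j).w ≤ 0 ∧
    0 < slopeForm m n (strip m n l₀ lₐ j).u := by
  induction j with
  | zero =>
    simp [strip, slopeForm]
    omega
  | succ j ih =>
    by_cases h : 0 < slopeForm m n (strip m n l₀ lₐ j).v
    · rw [strip_succ_pos h]; exact ⟨ih.1, h⟩
    · rw [strip_succ_nonpos h]; exact ⟨not_lt.1 h, ih.2⟩

lemma strip_w_ne_u (hmn : 0 < m + n) (j : ℕ) :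
    (strip m n l₀ lₐ j).w ≠ (strip m n l₀ lₐ j).u := by
  intro h
  have := strip_types (l₀ := l₀) (lₐ := lₐ) hmn j
  rw [h] at this
  omega

lemma strip_v_ne (hmn : 0 < m + n) (j : ℕ) :
    (strip m n l₀ lₐ j).v ≠ (strip m n l₀ lₐ j).w ∧
      (strip m n l₀ lₐ j).v ≠ (strip m n l₀ lₐ j).u := by
  induction j with
  | zero => simp [strip]
  | succ j ih =>
    have hwu := strip_w_ne_u (l₀ := l₀) (lₐ := lₐ) hmn j
    by_cases h : 0 < slopeForm m n (strip m n l₀ lₐ j).v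
    · rw [strip_succ_pos h]
      constructor
      · intro e
        rw [add_sub_assoc, add_eq_left, sub_eq_zero] at e
        exact ih.2 e
      · intro e
        rw [add_comm, add_sub_assoc, add_eq_left, sub_eq_zero] at e
        exact hwu e
    · rw [strip_succ_nonpos h]
      constructor
      · intro e
        rw [add_sub_assoc, add_eq_left, sub_eq_zero] at e
        exact hwu e.symm
      · intro e
        rw [add_comm, add_sub_assoc, add_eq_left, sub_eq_zero] at e
        exact ih.1 e

/-- Crossing the edge `w u` of a strip triangle leads back to the previous one. -/
lemma strip_back (j : ℕ) :
    ({(strip m n l₀ lₐ (j + 1)).w, (strip m n l₀ lₐ (j + 1)).u,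
      (strip m n l₀ lₐ (j + 1)).w + (strip m n l₀ lₐ (j + 1)).u - (strip m n l₀ lₐ (j + 1)).v} :
      Finset (ℤ × ℤ)) = (strip m n l₀ lₐ j).tri := by
  by_cases h : 0 < slopeForm m n (strip m n l₀ lₐ j).v
  · rw [strip_succ_pos h]
    simp only [StripState.tri, sub_sub_cancel]
    exact congrArg _ (Finset.pair_comm _ _)
  · rw [strip_succ_nonpos h]
    simp only [StripState.tri, sub_sub_cancel]
    rw [triple_rotate, Finset.pair_comm]

/-- The mixed edges of a strip triangle are `w u` and the one that leads to the next triangle. -/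
lemma strip_next (hmn : 0 < m + n) {j : ℕ} {A B U : ℤ × ℤ}
    (hT : (strip m n l₀ lₐ j).tri = {A, B, U}) (hA : slopeForm m n A ≤ 0)
    (hB : 0 < slopeForm m n B) :
    (A = (strip m n l₀ lₐ j).w ∧ B = (strip m n l₀ lₐ j).u ∧ U = (strip m n l₀ lₐ j).v) ∨
      {A, B, A + B - U} = (strip m n l₀ lₐ (j + 1)).tri := by
  have hw := (strip_types (l₀ := l₀) (lₐ := lₐ) hmn j).1
  have hu := (strip_types (l₀ := l₀) (lₐ := lₐ) hmn j).2
  have hwu := strip_w_ne_u (l₀ := l₀) (lₐ := lₐ) hmn j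
  obtain ⟨hvw, hvu⟩ := strip_v_ne (l₀ := l₀) (lₐ := lₐ) hmn j
  by_cases h : 0 < slopeForm m n (strip m n l₀ lₐ j).v
  · rw [strip_succ_pos h]
    generalize strip m n l₀ lₐ j = S at *
    obtain ⟨w, u, v, lw, lu⟩ := S
    simp only [StripState.tri] at *
    have mA : A ∈ ({w, u, v} : Finset (ℤ × ℤ)) := hT ▸ by simp
    have mB : B ∈ ({w, u, v} : Finset (ℤ × ℤ)) := hT ▸ by simp
    have mw : w ∈ ({A, B, U} : Finset (ℤ × ℤ)) := hT ▸ by simp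
    have mu : u ∈ ({A, B, U} : Finset (ℤ × ℤ)) := hT ▸ by simp
    have mv : v ∈ ({A, B, U} : Finset (ℤ × ℤ)) := hT ▸ by simp
    simp only [Finset.mem_insert, Finset.mem_singleton] at mA mB mw mu mv
    have eA : A = w := by
      rcases mA with rfl | rfl | rfl
      · rfl
      · omega
      · omega
    subst eA
    rcases mB with rfl | rfl | rfl
    · omega
    · left
      exact ⟨rfl, rfl, ((mv.resolve_left hvw).resolve_left hvu).symm⟩
    · right
      rw [(mu.resolve_left hwu.symm).resolve_left hvu.symm]
  · rw [strip_succ_nonpos h]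
    generalize strip m n l₀ lₐ j = S at *
    obtain ⟨w, u, v, lw, lu⟩ := S
    simp only [StripState.tri] at *
    have mA : A ∈ ({w, u, v} : Finset (ℤ × ℤ)) := hT ▸ by simp
    have mB : B ∈ ({w, u, v} : Finset (ℤ × ℤ)) := hT ▸ by simp
    have mw : w ∈ ({A, B, U} : Finset (ℤ × ℤ)) := hT ▸ by simp
    have mv : v ∈ ({A, B, U} : Finset (ℤ × ℤ)) := hT ▸ by simp
    simp only [Finset.mem_insert, Finset.mem_singleton] at mA mB mw mv
    have eB : B = u := by
      rcases mB with rfl | rfl | rfl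
      · omega
      · rfl
      · omega
    subst eB
    rcases mA with rfl | rfl | rfl
    · left
      exact ⟨rfl, rfl, ((mv.resolve_left hvw).resolve_left hvu).symm⟩
    · omega
    · right
      rw [(mw.resolve_left hvw.symm).resolve_left hwu]

/-- The strip crosses the lines `x + y = h` of the lattice one after the other. -/
lemma strip_even (hmn : 0 < m + n) (h : ℕ) :
    (strip m n l₀ lₐ (2 * h)).w = ((h : ℤ) - (n * h / (m + n) : ℕ), ((n * h / (m + n) : ℕ) : ℤ)) ∧
    (strip m n l₀ lₐ (2 * h)).u = (strip m n l₀ lₐ (2 * h)).w + (-1, 1) ∧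
    (strip m n l₀ lₐ (2 * h)).v = (strip m n l₀ lₐ (2 * h)).w + (0, 1) ∧
    (strip m n l₀ lₐ (2 * h)).lw = slopeWord m n h 0 0 • l₀ + slopeWord m n h 1 0 • (lₐ - l₀) ∧
    (strip m n l₀ lₐ (2 * h)).lu = slopeWord m n h 0 1 • l₀ + slopeWord m n h 1 1 • (lₐ - l₀) := by
  induction h with
  | zero => simp [strip, slopeWord, wordProd]
  | succ h ih =>
    obtain ⟨h1, h2, h3, h4, h5⟩ := ih
    have hu := (strip_types (l₀ := l₀) (lₐ := lₐ) hmn (2 * h)).2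
    have hw := (strip_types (l₀ := l₀) (lₐ := lₐ) hmn (2 * h)).1
    have hlt : n * h < (m + n) * (n * h / (m + n) + 1) := Nat.lt_mul_div_succ _ hmn
    have e2 : 2 * (h + 1) = 2 * h + 1 + 1 := by ring
    have hword : slopeWord m n (h + 1) = slopeWord m n h * (if n * (h + 1) / (m + n) =
      n * h / (m + n) then !![2, 1; 1, 1] else !![1, 1; 1, 2]) := rfl
    rw [e2]
    by_cases hv : 0 < slopeForm m n (strip m n l₀ lₐ (2 * h)).v
    · have hv' : slopeForm m n (strip m n l₀ lₐ (2 * h + 1)).v ≤ 0 := by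
        rw [strip_succ_pos hv]
        simp only [h2, h3, slopeForm] at hw ⊢
        simp
        linarith
      have hy : n * (h + 1) / (m + n) = n * h / (m + n) := by
        apply Nat.div_eq_of_lt_le
        · exact (Nat.div_mul_le_self _ _).trans (Nat.mul_le_mul_left _ (by omega))
        · rw [h3, h1] at hv
          simp only [slopeForm, Prod.fst_add, Prod.snd_add] at hv
          zify
          push_cast at hv
          linarith
      -- Labels: `(lw, lu) ↦ (lw, lw + lu) ↦ (2 lw + lu, lw + lu)`, the matrix `A`.
      rw [strip_succ_nonpos hv'.not_gt, strip_succ_pos hv, hword, if_pos hy, hy]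
      generalize strip m n l₀ lₐ (2 * h) = S at *
      generalize slopeWord m n h = W at *
      obtain ⟨w, u, v, lw, lu⟩ := S
      simp only [StripState.lv] at *
      subst h1 h2 h3 h4 h5
      refine ⟨?_, ?_, ?_, ?_, ?_⟩
      · simp; ring
      · simp
      · simp
      · ext <;> simp [Matrix.mul_apply, Fin.sum_univ_two] <;> ring
      · ext <;> simp [Matrix.mul_apply, Fin.sum_univ_two] <;> ring
    · have hv' : 0 < slopeForm m n (strip m n l₀ lₐ (2 * h + 1)).v := by
        rw [strip_succ_nonpos hv]
        simp only [h2, h3, slopeForm] at hu ⊢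
        simp at hu ⊢
        linarith
      have hy : n * (h + 1) / (m + n) = n * h / (m + n) + 1 := by
        apply Nat.div_eq_of_lt_le
        · rw [h3, h1] at hv
          simp only [slopeForm, Prod.fst_add, Prod.snd_add] at hv
          zify
          push_cast at hv
          linarith
        · zify at hlt ⊢
          linarith
      -- Labels: `(lw, lu) ↦ (lw + lu, lu) ↦ (lw + lu, lw + 2 lu)`, the matrix `B`.
      rw [strip_succ_pos hv', strip_succ_nonpos hv, hword, if_neg (by omega), hy]
      generalize strip m n l₀ lₐ (2 * h) = S at *
      generalize slopeWord m n h = W at *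
      obtain ⟨w, u, v, lw, lu⟩ := S
      simp only [StripState.lv] at *
      subst h1 h2 h3 h4 h5
      refine ⟨?_, ?_, ?_, ?_, ?_⟩
      · simp
      · simp; ring
      · simp; ring
      · ext <;> simp [Matrix.mul_apply, Fin.sum_univ_two] <;> ring
      · ext <;> simp [Matrix.mul_apply, Fin.sum_univ_two] <;> ring

end strip

/-! ### New vertices and labels in the strip -/

section strip

variable {m n : ℕ} {l₀ lₐ : ℤ × ℤ}

lemma strip_odd (hmn : 0 < m + n) (h : ℕ) :
    (strip m n l₀ lₐ (2 * h + 1)).v.1 + (strip m n l₀ lₐ (2 * h + 1)).v.2 = h + 1 ∧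
    (0 < slopeForm m n (strip m n l₀ lₐ (2 * h)).v ↔
      ¬ 0 < slopeForm m n (strip m n l₀ lₐ (2 * h + 1)).v) := by
  obtain ⟨h1, h2, h3, -, -⟩ := strip_even (l₀ := l₀) (lₐ := lₐ) hmn h
  have hu := (strip_types (l₀ := l₀) (lₐ := lₐ) hmn (2 * h)).2
  have hw := (strip_types (l₀ := l₀) (lₐ := lₐ) hmn (2 * h)).1
  by_cases hv : 0 < slopeForm m n (strip m n l₀ lₐ (2 * h)).v
  · simp only [hv, true_iff]
    rw [strip_succ_pos hv]
    simp only [h2, h3, slopeForm] at hw ⊢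
    constructor
    · simp [h1]
      ring
    · simp
      linarith
  · simp only [hv, false_iff, not_not]
    rw [strip_succ_nonpos hv]
    simp only [h2, h3, slopeForm] at hu ⊢
    constructor
    · simp [h1]
      ring
    · simp at hu ⊢
      linarith

lemma strip_v_sum (hmn : 0 < m + n) (j : ℕ) :
    (strip m n l₀ lₐ j).v.1 + (strip m n l₀ lₐ j).v.2 = (j / 2 : ℕ) + 1 := by
  rcases Nat.even_or_odd' j with ⟨h, rfl | rfl⟩
  · obtain ⟨h1, -, h3, -, -⟩ := strip_even (l₀ := l₀) (lₐ := lₐ) hmn h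
    rw [h3, h1, Nat.mul_div_cancel_left _ two_pos]
    simp
    ring
  · rw [(strip_odd hmn h).1]
    congr 2
    omega

/-- The height of a new vertex determines its index up to parity, and of the two new vertices at one
height exactly one lies on the left. -/
lemma strip_v_injective (hmn : 0 < m + n) :
    Function.Injective fun j => (strip m n l₀ lₐ j).v := by
  intro i j hij
  dsimp only at hij
  have hi := strip_v_sum (l₀ := l₀) (lₐ := lₐ) hmn i
  have hj := strip_v_sum (l₀ := l₀) (lₐ := lₐ) hmn j
  rw [hij] at hi
  have hd : i / 2 = j / 2 := by omega
  rcases Nat.even_or_odd' i with ⟨a, rfl | rfl⟩ <;> rcases Nat.even_or_odd' j with ⟨b, rfl | rfl⟩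
  · omega
  · obtain rfl : a = b := by omega
    have := (strip_odd (l₀ := l₀) (lₐ := lₐ) hmn a).2
    rw [hij] at this
    tauto
  · obtain rfl : a = b := by omega
    have := (strip_odd (l₀ := l₀) (lₐ := lₐ) hmn a).2
    rw [hij] at this
    tauto
  · omega

/-- The right vertices of a strip are `0` and new vertices of earlier triangles. -/
lemma strip_w_eq (j : ℕ) :
    (strip m n l₀ lₐ j).w = (0, 0) ∨
      ∃ i < j, (strip m n l₀ lₐ j).w = (strip m n l₀ lₐ i).v ∧
        (strip m n l₀ lₐ j).lw = (strip m n l₀ lₐ i).lv := by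
  induction j with
  | zero => exact Or.inl rfl
  | succ j ih =>
    by_cases h : 0 < slopeForm m n (strip m n l₀ lₐ j).v
    · rw [strip_succ_pos h]
      exact ih.imp id fun ⟨i, hi, h'⟩ => ⟨i, by omega, h'⟩
    · rw [strip_succ_nonpos h]
      exact Or.inr ⟨j, by omega, rfl, rfl⟩

/-- The left vertices of a strip are `ω - 1` and new vertices of earlier triangles. -/
lemma strip_u_eq (j : ℕ) :
    (strip m n l₀ lₐ j).u = (-1, 1) ∨
      ∃ i < j, (strip m n l₀ lₐ j).u = (strip m n l₀ lₐ i).v := by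
  induction j with
  | zero => exact Or.inl rfl
  | succ j ih =>
    by_cases h : 0 < slopeForm m n (strip m n l₀ lₐ j).v
    · rw [strip_succ_pos h]
      exact Or.inr ⟨j, by omega, rfl⟩
    · rw [strip_succ_nonpos h]
      exact ih.imp id fun ⟨i, hi, h'⟩ => ⟨i, by omega, h'⟩

/-- The edge through which a strip triangle is entered belongs to the previous triangle. -/
lemma strip_entry_mem (j : ℕ) :
    (strip m n l₀ lₐ (j + 1)).w ∈ (strip m n l₀ lₐ j).tri ∧
      (strip m n l₀ lₐ (j + 1)).u ∈ (strip m n l₀ lₐ j).tri := by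
  rw [← strip_back]
  simp

lemma strip_erase (hmn : 0 < m + n) (j : ℕ) : (strip m n l₀ lₐ j).tri.erase (strip m n l₀ lₐ j).v =
    {(strip m n l₀ lₐ j).w, (strip m n l₀ lₐ j).u} := by
  obtain ⟨h1, h2⟩ := strip_v_ne (l₀ := l₀) (lₐ := lₐ) hmn j
  rw [StripState.tri, triple_rotate, Finset.erase_insert]
  simp [h1, h2]

/-- A labelling that obeys the Farey rule along the strip is the one given by the strip. -/
lemma strip_labels {L : ℤ × ℤ → ℤ × ℤ} {a M : ℕ}
    (hw : L (strip m n l₀ lₐ a).w = (strip m n l₀ lₐ a).lw)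
    (hu : L (strip m n l₀ lₐ a).u = (strip m n l₀ lₐ a).lu)
    (hv : ∀ j, a ≤ j → j ≤ M →
      L (strip m n l₀ lₐ j).w = (strip m n l₀ lₐ j).lw →
      L (strip m n l₀ lₐ j).u = (strip m n l₀ lₐ j).lu →
      L (strip m n l₀ lₐ j).v = (strip m n l₀ lₐ j).lv) :
    ∀ j, a ≤ j → j ≤ M → L (strip m n l₀ lₐ j).w = (strip m n l₀ lₐ j).lw ∧
      L (strip m n l₀ lₐ j).u = (strip m n l₀ lₐ j).lu ∧
      L (strip m n l₀ lₐ j).v = (strip m n l₀ lₐ j).lv := by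
  intro j haj
  induction j, haj using Nat.le_induction with
  | base => exact fun hM => ⟨hw, hu, hv a le_rfl hM hw hu⟩
  | succ j haj ih =>
    intro hM
    obtain ⟨h1, h2, h3⟩ := ih (by omega)
    have h4 := hv (j + 1) (by omega) hM
    by_cases h : 0 < slopeForm m n (strip m n l₀ lₐ j).v
    · rw [strip_succ_pos h] at h4 ⊢
      exact ⟨h1, h3, h4 h1 h3⟩
    · rw [strip_succ_nonpos h] at h4 ⊢
      exact ⟨h3, h2, h4 h3 h2⟩

end strip

/-! ### Mixed paths and their labels -/

/-- A path of triangles that leaves every triangle through an edge with one vertex on each side of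
the ray of direction `(m, n)`, does not turn back, and starts along the left side of this ray. -/
structure MixedPath (m n N : ℕ) (τ : ℕ → Finset (ℤ × ℤ)) : Prop where
  pos : 0 < N
  edge : ∀ j < N, ∃ A B U : ℤ × ℤ, τ j = {A, B, U} ∧ τ (j + 1) = {A, B, A + B - U} ∧
    slopeForm m n A ≤ 0 ∧ 0 < slopeForm m n B
  noBack : ∀ j, j + 2 ≤ N → τ j ≠ τ (j + 2)
  start : (0 < m ∧ τ 0 = {(0, 0), (0, 1), (1, 0)} ∧ τ 1 = {(1, 0), (0, 1), (1, 1)}) ∨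
    (m = 0 ∧ τ 0 = {(0, 0), (-1, 1), (0, 1)} ∧ τ 1 = {(0, 1), (-1, 1), (-1, 2)})

/-- The position in the strip where a mixed path starts. -/
def stripStart (m : ℕ) : ℕ := if m = 0 then 0 else 1

lemma strip_one_zero {n : ℕ} (l₀ lₐ : ℤ × ℤ) :
    strip 0 n l₀ lₐ 1 = ⟨(0, 1), (-1, 1), (-1, 2), lₐ, lₐ - l₀⟩ := by
  simp [strip, slopeForm, StripState.lv]

/-- For `m > 0` the path skips the triangle `[0, ω - 1, ω]` of the strip and starts here; this is
the shift by `stripStart`. -/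
lemma strip_one_pos {m n : ℕ} (hm : 0 < m) (l₀ lₐ : ℤ × ℤ) :
    strip m n l₀ lₐ 1 = ⟨(0, 0), (0, 1), (1, 0), l₀, lₐ⟩ := by
  simp [strip, slopeForm, StripState.lv, hm]

lemma strip_two_pos {m n : ℕ} (hm : 0 < m) (l₀ lₐ : ℤ × ℤ) :
    strip m n l₀ lₐ 2 = ⟨(1, 0), (0, 1), (1, 1), l₀ + lₐ, lₐ⟩ := by
  rw [strip_succ_nonpos] <;> rw [strip_one_pos hm] <;> simp [slopeForm, StripState.lv]

/-- A strip triangle has only two mixed edges. One of them leads back to the previous triangle,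
which `noBack` forbids, so the path is forced once its first two triangles are known. -/
lemma MixedPath.eq_strip {m n N : ℕ} {τ : ℕ → Finset (ℤ × ℤ)} (h : MixedPath m n N τ)
    (hmn : 0 < m + n) (l₀ lₐ : ℤ × ℤ) :
    ∀ j ≤ N, τ j = (strip m n l₀ lₐ (j + stripStart m)).tri := by
  have base : τ 0 = (strip m n l₀ lₐ (0 + stripStart m)).tri ∧
      τ 1 = (strip m n l₀ lₐ (1 + stripStart m)).tri := by
    rcases h.start with ⟨hm, h0, h1⟩ | ⟨rfl, h0, h1⟩
    · simp only [stripStart, hm.ne', if_false, zero_add, Nat.reduceAdd]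
      rw [strip_one_pos hm, strip_two_pos hm]
      exact ⟨h0, h1⟩
    · simp only [stripStart, if_true, add_zero]
      rw [strip_one_zero]
      exact ⟨h0, h1⟩
  intro j
  induction j using Nat.strong_induction_on with
  | _ j ih =>
    intro hj
    match j, ih, hj with
    | 0, _, _ => exact base.1
    | 1, _, _ => exact base.2
    | j + 2, ih, hj =>
      obtain ⟨A, B, U, h1, h2, hA, hB⟩ := h.edge (j + 1) (by omega)
      have e := ih (j + 1) (by omega) (by omega)
      have e' := ih j (by omega) (by omega)
      rcases strip_next hmn (e.symm.trans h1) hA hB with ⟨rfl, rfl, rfl⟩ | h3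
      · refine absurd (e'.trans ?_) (h.noBack j hj)
        rw [h2, ← strip_back]
        rw [show j + 1 + stripStart m = j + stripStart m + 1 by ring]
      · rw [h2, h3]
        congr 2
        ring

/-- A Farey labelling with arbitrary labels at `0`, `1`, `ω`. -/
structure FareyAlong (e₀ e₁ e₂ : ℤ × ℤ) (N : ℕ) (τ : ℕ → Finset (ℤ × ℤ)) (L : ℤ × ℤ → ℤ × ℤ) :
    Prop where
  label_zero : L (0, 0) = e₀
  label_one : L (1, 0) = e₁
  label_omega : L (0, 1) = e₂
  label_step : ∀ j ≤ N, (j = 0 ∧ τ 0 = {(0, 0), (1, 0), (0, 1)}) ∨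
    ∃ v, τ j \ labelledBefore τ j = {v} ∧ L v = ∑ w ∈ (τ j).erase v, L w

lemma subset_labelledBefore {τ : ℕ → Finset (ℤ × ℤ)} {i j : ℕ} (hij : i < j) :
    τ i ⊆ labelledBefore τ j := by
  intro v hv
  simp only [labelledBefore, Finset.mem_union, Finset.mem_biUnion, Finset.mem_range]
  exact Or.inr ⟨i, hij, hv⟩

/-- Each later triangle has a vertex that belongs to no earlier one. -/
lemma FareyAlong.ne {e₀ e₁ e₂ : ℤ × ℤ} {N : ℕ} {τ : ℕ → Finset (ℤ × ℤ)} {L : ℤ × ℤ → ℤ × ℤ}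
    (h : FareyAlong e₀ e₁ e₂ N τ L) {i j : ℕ} (hij : i < j) (hj : j ≤ N) : τ i ≠ τ j := by
  intro e
  rcases h.label_step j hj with ⟨rfl, -⟩ | ⟨v, hv, -⟩
  · omega
  · have : v ∈ τ j \ labelledBefore τ j := hv ▸ Finset.mem_singleton_self v
    rw [Finset.mem_sdiff, ← e] at this
    exact this.2 (subset_labelledBefore hij this.1)

/-- The comparison starts at the second triangle because the label `e₀` of `0` may differ from `l₀`.
For `m > 0` it is no longer needed there; for `m = 0` it enters only through `e₀ + lₐ = lₐ - l₀` at
`ω - 1`. -/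
lemma MixedPath.label_base {m n N : ℕ} {τ : ℕ → Finset (ℤ × ℤ)} (h : MixedPath m n N τ)
    {l₀ lₐ e₀ : ℤ × ℤ} {L : ℤ × ℤ → ℤ × ℤ}
    (hL : FareyAlong e₀ (l₀ + lₐ) lₐ N τ L) (he : m = 0 → e₀ = -l₀) :
    L (strip m n l₀ lₐ (stripStart m + 1)).w = (strip m n l₀ lₐ (stripStart m + 1)).lw ∧
    L (strip m n l₀ lₐ (stripStart m + 1)).u = (strip m n l₀ lₐ (stripStart m + 1)).lu := by
  rcases h.start with ⟨hm, h0, -⟩ | ⟨rfl, h0, -⟩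
  · simp only [stripStart, hm.ne', if_false, Nat.reduceAdd]
    rw [strip_two_pos hm]
    exact ⟨hL.label_one, hL.label_omega⟩
  · simp only [stripStart, if_true, zero_add]
    rw [strip_one_zero]
    refine ⟨hL.label_omega, ?_⟩
    have hb : τ 0 \ labelledBefore τ 0 = {(-1, 1)} := by
      rw [h0, labelledBefore, Finset.range_zero, Finset.biUnion_empty]
      decide
    rcases hL.label_step 0 (Nat.zero_le _) with ⟨-, h1⟩ | ⟨v, h1, h2⟩
    · rw [h0] at h1
      exact absurd h1 (by decide)
    · obtain rfl := Finset.singleton_injective (h1.symm.trans hb)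
      rw [h0, show ({(0, 0), (-1, 1), (0, 1)} : Finset (ℤ × ℤ)).erase (-1, 1) = {(0, 0), (0, 1)} by
        decide, Finset.sum_pair (by decide), hL.label_zero, hL.label_omega, he rfl] at h2
      rw [h2]
      simp only
      abel

/-- The label at the lattice point `(k m, k n)` of the last triangle of a labelled mixed path. -/
theorem MixedPath.label_eq {m n N : ℕ} {τ : ℕ → Finset (ℤ × ℤ)} (h : MixedPath m n N τ)
    (hmn : 0 < m + n) {l₀ lₐ e₀ : ℤ × ℤ} {L : ℤ × ℤ → ℤ × ℤ}
    (hL : FareyAlong e₀ (l₀ + lₐ) lₐ N τ L) (he : m = 0 → e₀ = -l₀) {k : ℕ} (hk : 2 ≤ k)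
    (hmem : ((k * m : ℤ), (k * n : ℤ)) ∈ τ N) :
    L ((k * m : ℤ), (k * n : ℤ)) = (periodMatrix m n ^ k) 0 0 • l₀ +
      (periodMatrix m n ^ k) 1 0 • (lₐ - l₀) := by
  have hτ := h.eq_strip hmn l₀ lₐ
  obtain ⟨bw, bu⟩ := h.label_base hL he
  have hpos := h.pos
  have hlab := strip_labels bw bu (M := N + stripStart m) (by
    intro j h1 h2 hjw hju
    obtain ⟨i, rfl⟩ : ∃ i, j = i + 1 + stripStart m := ⟨j - stripStart m - 1, by omega⟩
    have ht := hτ (i + 1) (by omega)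
    rcases hL.label_step (i + 1) (by omega) with ⟨h3, -⟩ | ⟨v, h3, h4⟩
    · omega
    · have hmem : v ∈ τ (i + 1) \ labelledBefore τ (i + 1) := h3 ▸ Finset.mem_singleton_self v
      rw [Finset.mem_sdiff] at hmem
      obtain ⟨hv1, hv2⟩ := hmem
      have hsub := subset_labelledBefore (τ := τ) (Nat.lt_succ_self i)
      have hent := strip_entry_mem (m := m) (n := n) (l₀ := l₀) (lₐ := lₐ) (i + stripStart m)
      rw [← hτ i (by omega), show i + stripStart m + 1 = i + 1 + stripStart m by ring] at hent
      -- The entry edge was labelled with the previous triangle, so the only unlabelled vertex is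
      -- the new vertex of the strip.
      have hv : v = (strip m n l₀ lₐ (i + 1 + stripStart m)).v := by
        rw [ht, StripState.tri] at hv1
        simp only [Finset.mem_insert, Finset.mem_singleton] at hv1
        rcases hv1 with rfl | rfl | rfl
        · exact absurd (hsub hent.1) hv2
        · exact absurd (hsub hent.2) hv2
        · rfl
      rw [← hv, h4, ht, hv, strip_erase hmn, Finset.sum_pair (strip_w_ne_u hmn _), hjw, hju,
        StripState.lv])
  obtain ⟨e1, -, -, e4, -⟩ := strip_even (l₀ := l₀) (lₐ := lₐ) hmn (k * (m + n))
  rw [slopeWord_mul_period m n hmn] at e4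
  have hdiv : n * (k * (m + n)) / (m + n) = k * n := by
    rw [← mul_assoc, Nat.mul_div_cancel _ hmn, mul_comm]
  rw [hdiv] at e1
  have ew : (strip m n l₀ lₐ (2 * (k * (m + n)))).w = ((k * m : ℤ), (k * n : ℤ)) := by
    rw [e1]
    push_cast
    ext
    · simp only
      ring
    · rfl
  have hsum : 2 ≤ k * (m + n) := by nlinarith
  -- The path may end before the strip position at which the target is `w`; the label has to be
  -- taken where the target first appears, as a new vertex.
  rcases strip_w_eq (m := m) (n := n) (l₀ := l₀) (lₐ := lₐ) (2 * (k * (m + n))) with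
    h0 | ⟨i, -, hi, hl⟩
  · rw [ew, Prod.mk.injEq] at h0
    zify at hsum
    nlinarith
  · have hisum := strip_v_sum (l₀ := l₀) (lₐ := lₐ) hmn i
    rw [← hi, ew] at hisum
    zify at hsum
    -- Agreement with the strip labels is only available from position `stripStart m + 1` on, which
    -- is at most `2`.
    have hi2 : 2 ≤ i := by
      have : (2 : ℤ) ≤ (i / 2 : ℕ) + 1 := by rw [← hisum]; linarith
      omega
    rw [← e4, hl, ← ew, hi]
    have hs : stripStart m ≤ 1 := by unfold stripStart; split_ifs <;> omega
    refine (hlab i (by omega) ?_).2.2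
    -- `i` is at most the index of the last triangle
    rw [← ew, hi, hτ N le_rfl, StripState.tri] at hmem
    simp only [Finset.mem_insert, Finset.mem_singleton] at hmem
    rcases hmem with hm | hm | hm
    · rcases strip_w_eq (m := m) (n := n) (l₀ := l₀) (lₐ := lₐ) (N + stripStart m) with
        h1 | ⟨i', h1, h2, -⟩
      · rw [← hi, ew] at hm
        rw [← hm, Prod.mk.injEq] at h1
        nlinarith
      · have := strip_v_injective hmn (hm.trans h2)
        omega
    · rcases strip_u_eq (m := m) (n := n) (l₀ := l₀) (lₐ := lₐ) (N + stripStart m) with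
        h1 | ⟨i', h1, h2⟩
      · rw [← hi, ew] at hm
        rw [← hm, Prod.mk.injEq] at h1
        nlinarith
      · have := strip_v_injective hmn (hm.trans h2)
        omega
    · exact (strip_v_injective hmn hm).le

lemma strip_v_ne_of_sum {m n : ℕ} {l₀ lₐ : ℤ × ℤ} (hmn : 0 < m + n) (j : ℕ) {v : ℤ × ℤ}
    (hv : v.1 + v.2 ≤ 0) : (strip m n l₀ lₐ j).v ≠ v := by
  rintro rfl
  rw [strip_v_sum hmn] at hv
  omega

lemma strip_tri_ne_v {m n : ℕ} {l₀ lₐ : ℤ × ℤ} (hmn : 0 < m + n) {i j : ℕ} (hij : i < j) :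
    (strip m n l₀ lₐ j).v ∉ (strip m n l₀ lₐ i).tri := by
  have key : ∀ i' ≤ i, (strip m n l₀ lₐ j).v ≠ (strip m n l₀ lₐ i').v := fun i' hi' h => by
    have := strip_v_injective hmn h
    omega
  simp only [StripState.tri, Finset.mem_insert, Finset.mem_singleton, not_or]
  refine ⟨?_, ?_, key i le_rfl⟩
  · rcases strip_w_eq (m := m) (n := n) (l₀ := l₀) (lₐ := lₐ) i with h | ⟨i', h1, h2, -⟩
    · rw [h]
      exact strip_v_ne_of_sum hmn j (by simp)
    · rw [h2]
      exact key i' h1.le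
  · rcases strip_u_eq (m := m) (n := n) (l₀ := l₀) (lₐ := lₐ) i with h | ⟨i', h1, h2⟩
    · rw [h]
      exact strip_v_ne_of_sum hmn j (by simp)
    · rw [h2]
      exact key i' h1.le

/-- A mixed path carries a Farey labelling. -/
theorem MixedPath.exists_labelling {m n N : ℕ} {τ : ℕ → Finset (ℤ × ℤ)} (h : MixedPath m n N τ)
    (hmn : 0 < m + n) {l₀ lₐ e₀ : ℤ × ℤ} (he : m = 0 → e₀ = -l₀) :
    ∃ L, FareyAlong e₀ (l₀ + lₐ) lₐ N τ L := by
  have hτ := h.eq_strip hmn l₀ lₐ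
  have hinj := strip_v_injective (l₀ := l₀) (lₐ := lₐ) hmn
  -- Values at the starting vertices that are never new in the strip: `0`, `ω - 1`, and also `1`
  -- when `m = 0`.
  let g : ℤ × ℤ → ℤ × ℤ := fun P =>
    if P = (0, 0) then e₀ else if P = (1, 0) then l₀ + lₐ else lₐ - l₀
  let L : ℤ × ℤ → ℤ × ℤ :=
    Function.extend (fun j => (strip m n l₀ lₐ j).v) (fun j => (strip m n l₀ lₐ j).lv) g
  have Lv : ∀ j, L (strip m n l₀ lₐ j).v = (strip m n l₀ lₐ j).lv := fun j =>
    hinj.extend_apply (fun j => (strip m n l₀ lₐ j).lv) g j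
  have Ln : ∀ v : ℤ × ℤ, (∀ j, (strip m n l₀ lₐ j).v ≠ v) → L v = g v := fun v hv =>
    Function.extend_apply' _ _ _ fun ⟨j, hj⟩ => hv j hj
  have L0 : L (0, 0) = e₀ := by
    rw [Ln _ fun j => strip_v_ne_of_sum hmn j (by simp)]
    simp [g]
  have Lu : L (-1, 1) = lₐ - l₀ := by
    rw [Ln _ fun j => strip_v_ne_of_sum hmn j (by simp)]
    simp [g]
  have Lω : L (0, 1) = lₐ := (Lv 0).trans (by simp [strip, StripState.lv])
  have L1 : L (1, 0) = l₀ + lₐ := by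
    rcases Nat.eq_zero_or_pos m with rfl | hm
    · rw [Ln]
      · simp [g]
      · intro j hj
        have hs := strip_v_sum (l₀ := l₀) (lₐ := lₐ) hmn j
        rw [hj] at hs
        have : j = 0 ∨ j = 1 := by simp at hs; omega
        rcases this with rfl | rfl
        · simp [strip] at hj
        · rw [strip_one_zero] at hj
          simp at hj
    · have := Lv 1
      rwa [strip_one_pos hm] at this
  have base : L (strip m n l₀ lₐ (stripStart m + 1)).w = (strip m n l₀ lₐ (stripStart m + 1)).lw ∧
      L (strip m n l₀ lₐ (stripStart m + 1)).u = (strip m n l₀ lₐ (stripStart m + 1)).lu := by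
    rcases Nat.eq_zero_or_pos m with rfl | hm
    · simp only [stripStart, if_true, zero_add]
      rw [strip_one_zero]
      exact ⟨Lω, Lu⟩
    · simp only [stripStart, hm.ne', if_false, Nat.reduceAdd]
      rw [strip_two_pos hm]
      exact ⟨L1, Lω⟩
  have hlab := strip_labels base.1 base.2 (M := N + stripStart m) fun j _ _ _ _ => Lv j
  refine ⟨L, L0, L1, Lω, fun j hj => ?_⟩
  rcases Nat.eq_zero_or_pos j with rfl | hj0
  · rcases h.start with ⟨hm, h0, -⟩ | ⟨rfl, h0, -⟩
    · left
      exact ⟨rfl, h0.trans (by decide)⟩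
    · right
      refine ⟨(-1, 1), ?_, ?_⟩
      · rw [h0, labelledBefore, Finset.range_zero, Finset.biUnion_empty]
        decide
      · rw [h0, show ({(0, 0), (-1, 1), (0, 1)} : Finset (ℤ × ℤ)).erase (-1, 1) =
          {(0, 0), (0, 1)} by decide, Finset.sum_pair (by decide), L0, Lω, Lu, he rfl]
        abel
  · right
    obtain ⟨i, rfl⟩ : ∃ i, j = i + 1 := ⟨j - 1, by omega⟩
    have ht := hτ (i + 1) hj
    refine ⟨(strip m n l₀ lₐ (i + 1 + stripStart m)).v, ?_, ?_⟩
    · have hsub := subset_labelledBefore (τ := τ) (Nat.lt_succ_self i)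
      have hent := strip_entry_mem (m := m) (n := n) (l₀ := l₀) (lₐ := lₐ) (i + stripStart m)
      rw [← hτ i (by omega), show i + stripStart m + 1 = i + 1 + stripStart m by ring] at hent
      have hnot : (strip m n l₀ lₐ (i + 1 + stripStart m)).v ∉ labelledBefore τ (i + 1) := by
        simp only [labelledBefore, Finset.mem_union, Finset.mem_biUnion, Finset.mem_range, not_or,
          not_exists, not_and]
        refine ⟨?_, ?_⟩
        · simp only [Finset.mem_insert, Finset.mem_singleton, not_or]
          refine ⟨strip_v_ne_of_sum hmn _ (by simp), ?_, ?_⟩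
          · intro hv
            rcases Nat.eq_zero_or_pos m with rfl | hm
            · have hs := strip_v_sum (m := 0) (n := n) (l₀ := l₀) (lₐ := lₐ) hmn (i + 1)
              simp only [stripStart, if_true, add_zero] at hv
              rw [hv] at hs
              obtain rfl : i = 0 := by simp at hs; omega
              rw [strip_one_zero] at hv
              simp at hv
            · have : (strip m n l₀ lₐ 1).v = (1, 0) := by rw [strip_one_pos hm]
              have := hinj (hv.trans this.symm)
              simp [stripStart, hm.ne'] at this
          · intro hv
            have : (strip m n l₀ lₐ 0).v = (0, 1) := rfl
            have := hinj (hv.trans this.symm)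
            omega
        · intro i' hi'
          rw [hτ i' (by omega)]
          exact strip_tri_ne_v hmn (by omega)
      rw [ht]
      ext v
      simp only [Finset.mem_sdiff, Finset.mem_singleton, StripState.tri, Finset.mem_insert]
      constructor
      · rintro ⟨rfl | rfl | rfl, h2⟩
        · exact absurd (hsub hent.1) h2
        · exact absurd (hsub hent.2) h2
        · rfl
      · rintro rfl
        exact ⟨Or.inr (Or.inr rfl), hnot⟩
    · obtain ⟨h1, h2, h3⟩ := hlab (i + 1 + stripStart m) (by omega) (by omega)
      rw [ht, strip_erase hmn, Finset.sum_pair (strip_w_ne_u hmn _), h1, h2, h3, StripState.lv]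

/-! ### The bent segment in lattice coordinates -/

/-- First coordinate of the left-bent segment from `0` to `k (m + n ω)`, where `δ = ε / √3`. -/
noncomputable def curveX (m n k : ℕ) (δ t : ℝ) : ℝ := k * (m * t - δ * (m + 2 * n) * (t * (1 - t)))

/-- Second coordinate of the left-bent segment from `0` to `k (m + n ω)`, where `δ = ε / √3`. -/
noncomputable def curveY (m n k : ℕ) (δ t : ℝ) : ℝ := k * (n * t + δ * (2 * m + n) * (t * (1 - t)))

/-- The bend is `i (m + n ω) = (-(m + 2n) + (2m + n) ω) / √3`, whence the scale `ε / √3`. -/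
lemma bentSegment_one (m n k : ℕ) (ε t : ℝ) : bentSegment m n k 1 ε t =
    planePoint (curveX m n k (ε / √3) t) (curveY m n k (ε / √3) t) := by
  have h3 : √3 ≠ 0 := by positivity
  have h33 : √3 * √3 = 3 := Real.mul_self_sqrt (by norm_num)
  have hε : ε = ε / √3 * √3 := by field_simp
  generalize ε / √3 = δ at *
  subst hε
  apply Complex.ext
  · simp [bentSegment, eisPoint, planePoint, eisOmega, curveX, curveY]
    linear_combination (-(δ * t * (1 - t) * k * n / 2)) * h33
  · simp [bentSegment, eisPoint, planePoint, eisOmega, curveX, curveY]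
    ring

/-- Interchanging the coordinates is a reflection; it reverses orientation and turns a right bend in
direction `(m, n)` into a left bend in direction `(n, m)`. -/
lemma bentSegment_neg_one (m n k : ℕ) (ε t : ℝ) : bentSegment m n k (-1) ε t =
    planePoint (curveY n m k (ε / √3) t) (curveX n m k (ε / √3) t) := by
  have h3 : √3 ≠ 0 := by positivity
  have h33 : √3 * √3 = 3 := Real.mul_self_sqrt (by norm_num)
  have hε : ε = ε / √3 * √3 := by field_simp
  generalize ε / √3 = δ at *
  subst hε
  apply Complex.ext
  · simp [bentSegment, eisPoint, planePoint, eisOmega, curveX, curveY]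
    linear_combination ((δ * t * (1 - t) * k * n / 2)) * h33
  · simp [bentSegment, eisPoint, planePoint, eisOmega, curveX, curveY]
    ring

/-- There is no lattice point on the curve or strictly between it and the segment from `0`. -/
def CurveFree (m n k : ℕ) (δ : ℝ) : Prop :=
  ∀ t : ℝ, 0 < t → t < 1 → ∀ r : ℝ, 0 < r → r ≤ 1 →
    ∀ v : ℤ × ℤ, ¬(curveX m n k (r * δ) t = v.1 ∧ curveY m n k (r * δ) t = v.2)

lemma latticeFree_one {m n k : ℕ} {ε : ℝ} :
    LatticeFree m n k 1 ε ↔ CurveFree m n k (ε / √3) := by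
  unfold LatticeFree CurveFree
  simp only [bentSegment_one, eisPoint_eq, ne_eq, planePoint_inj, mul_div_assoc]
  simp only [eq_comm]

lemma latticeFree_neg_one {m n k : ℕ} {ε : ℝ} :
    LatticeFree m n k (-1) ε ↔ CurveFree n m k (ε / √3) := by
  unfold LatticeFree CurveFree
  simp only [bentSegment_neg_one, eisPoint_eq, ne_eq, planePoint_inj, mul_div_assoc]
  constructor
  · intro h t h0 h1 r hr0 hr1 v hv
    exact h t h0 h1 r hr0 hr1 v.swap ⟨hv.2.symm, hv.1.symm⟩
  · intro h t h0 h1 r hr0 hr1 v hv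
    exact h t h0 h1 r hr0 hr1 v.swap ⟨hv.2.symm, hv.1.symm⟩

/-- The triangles `τ 0, …, τ N` crossed by a curve in coordinates, with the crossing times. -/
structure PlaneCrossing (X Y : ℝ → ℝ) (N : ℕ) (τ : ℕ → Finset (ℤ × ℤ)) (t : ℕ → ℝ) : Prop where
  tri : ∀ j ≤ N, IsEisTriangle (τ j)
  ne : ∀ j < N, τ j ≠ τ (j + 1)
  zero : t 0 = 0
  one : t (N + 1) = 1
  lt : ∀ j ≤ N, t j < t (j + 1)
  mem : ∀ j ≤ N, ∀ x ∈ Set.Icc (t j) (t (j + 1)), InTri (τ j) (X x) (Y x)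

lemma crossesTriangles_iff {X Y : ℝ → ℝ} {c : ℝ → ℂ} (hc : ∀ x, c x = planePoint (X x) (Y x))
    {N : ℕ} {τ : ℕ → Finset (ℤ × ℤ)} :
    CrossesTriangles c N τ ↔ ∃ t, PlaneCrossing X Y N τ t := by
  constructor
  · rintro ⟨h1, h2, t, h3, h4, h5⟩
    refine ⟨t, h1, h2, h3, h4, fun j hj => (h5 j hj).1, fun j hj x hx => ?_⟩
    rw [← mem_eisRegion_iff, ← hc]
    exact (h5 j hj).2 x hx
  · rintro ⟨t, h⟩
    refine ⟨h.tri, h.ne, t, h.zero, h.one, fun j hj => ⟨h.lt j hj, fun x hx => ?_⟩⟩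
    rw [hc, mem_eisRegion_iff]
    exact h.mem j hj x hx

/-! ### Reflection in the diagonal -/

/-- The reflected triangle. -/
def swapTri (T : Finset (ℤ × ℤ)) : Finset (ℤ × ℤ) := T.image Prod.swap

lemma swapTri_swapTri (T : Finset (ℤ × ℤ)) : swapTri (swapTri T) = T := by
  simp [swapTri, Finset.image_image]

lemma mem_swapTri {T : Finset (ℤ × ℤ)} {v : ℤ × ℤ} : v ∈ swapTri T ↔ v.swap ∈ T := by
  simp only [swapTri, Finset.mem_image]
  constructor
  · rintro ⟨w, hw, rfl⟩
    simpa using hw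
  · intro h
    exact ⟨v.swap, h, by simp⟩

lemma sum_swapTri {M : Type*} [AddCommMonoid M] (T : Finset (ℤ × ℤ)) (f : ℤ × ℤ → M) :
    ∑ v ∈ swapTri T, f v = ∑ v ∈ T, f v.swap :=
  Finset.sum_image fun _ _ _ _ h => Prod.swap_injective h

lemma isEisTriangle_swapTri {T : Finset (ℤ × ℤ)} (h : IsEisTriangle T) :
    IsEisTriangle (swapTri T) := by
  obtain ⟨w, σ, hσ, rfl⟩ := isEisTriangle_iff.1 h
  refine isEisTriangle_iff.2 ⟨w.swap, σ, hσ, ?_⟩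
  simp only [swapTri, tri, Finset.image_insert, Finset.image_singleton, Prod.swap]
  rw [Finset.pair_comm]

lemma inTri_swapTri {T : Finset (ℤ × ℤ)} {x y : ℝ} (h : InTri T x y) : InTri (swapTri T) y x := by
  obtain ⟨f, h1, h2, h3, h4⟩ := h
  refine ⟨fun v => f v.swap, fun v hv => h1 _ (mem_swapTri.1 hv), ?_, ?_, ?_⟩ <;>
  rw [sum_swapTri] <;> simpa

lemma PlaneCrossing.swap {X Y : ℝ → ℝ} {N : ℕ} {τ : ℕ → Finset (ℤ × ℤ)} {t : ℕ → ℝ}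
    (h : PlaneCrossing X Y N τ t) : PlaneCrossing Y X N (fun j => swapTri (τ j)) t where
  tri j hj := isEisTriangle_swapTri (h.tri j hj)
  ne j hj e := h.ne j hj (by rw [← swapTri_swapTri (τ j), e, swapTri_swapTri])
  zero := h.zero
  one := h.one
  lt := h.lt
  mem j hj x hx := inTri_swapTri (h.mem j hj x hx)

lemma labelledBefore_swap (τ : ℕ → Finset (ℤ × ℤ)) (j : ℕ) :
    labelledBefore (fun j => swapTri (τ j)) j = swapTri (labelledBefore τ j) := by
  ext ⟨a, b⟩
  simp only [labelledBefore, mem_swapTri, Finset.mem_union, Finset.mem_biUnion, Finset.mem_insert,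
    Finset.mem_singleton, Prod.swap_prod_mk, Prod.mk.injEq]
  tauto

/-- The reflection exchanges the starting labels at `1` and `ω`, which is why these are parameters.
-/
lemma FareyAlong.swap {e₀ e₁ e₂ : ℤ × ℤ} {N : ℕ} {τ : ℕ → Finset (ℤ × ℤ)} {L : ℤ × ℤ → ℤ × ℤ}
    (h : FareyAlong e₀ e₁ e₂ N τ L) :
    FareyAlong e₀ e₂ e₁ N (fun j => swapTri (τ j)) (fun v => L v.swap) where
  label_zero := h.label_zero
  label_one := h.label_omega
  label_omega := h.label_one
  label_step j hj := by
    rcases h.label_step j hj with ⟨h1, h2⟩ | ⟨v, h1, h2⟩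
    · left
      refine ⟨h1, ?_⟩
      rw [h2]
      decide
    · right
      refine ⟨v.swap, ?_, ?_⟩
      · rw [labelledBefore_swap]
        ext w
        have := congrArg (w.swap ∈ ·) h1
        simp only [Finset.mem_sdiff, Finset.mem_singleton, eq_iff_iff] at this
        simp only [Finset.mem_sdiff, Finset.mem_singleton, mem_swapTri, this]
        constructor
        · rintro rfl
          simp
        · rintro rfl
          simp
      · have : (swapTri (τ j)).erase v.swap = swapTri ((τ j).erase v) := by
          ext w
          simp only [Finset.mem_erase, mem_swapTri, ne_eq]
          constructor
          · rintro ⟨h3, h4⟩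
            exact ⟨fun e => h3 (by rw [← e, Prod.swap_swap]), h4⟩
          · rintro ⟨h3, h4⟩
            exact ⟨fun e => h3 (by rw [e, Prod.swap_swap]), h4⟩
        rw [this, sum_swapTri]
        simpa using h2

lemma isFareyLabelling_iff {e : ℤ} {N : ℕ} {τ : ℕ → Finset (ℤ × ℤ)} {L : ℤ × ℤ → ℤ × ℤ} :
    IsFareyLabelling e N τ L ↔ FareyAlong (e, 0) (0, 1) (1, 1) N τ L :=
  ⟨fun h => ⟨h.1, h.2, h.3, h.4⟩, fun h => ⟨h.1, h.2, h.3, h.4⟩⟩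

/-! ### Triangles on the two sides of an edge -/

lemma sum_triple {M : Type*} [AddCommMonoid M] {A B U : ℤ × ℤ}
    (h : (B.1 - A.1) * (U.2 - A.2) - (B.2 - A.2) * (U.1 - A.1) ≠ 0) (f : ℤ × ℤ → M) :
    ∑ v ∈ {A, B, U}, f v = f A + f B + f U := by
  rw [Finset.sum_insert, Finset.sum_pair, add_assoc]
  · rintro rfl
    apply h
    ring
  · simp only [Finset.mem_insert, Finset.mem_singleton, not_or]
    constructor
    · rintro rfl
      apply h
      ring
    · rintro rfl
      apply h
      ring

/-- The determinant, corrected by the orientation `d`, is the barycentric weight at `U`. -/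
lemma inTri_det {A B U : ℤ × ℤ} {d : ℤ} (hd : d = 1 ∨ d = -1)
    (h : (B.1 - A.1) * (U.2 - A.2) - (B.2 - A.2) * (U.1 - A.1) = d) {x y : ℝ}
    (hT : InTri {A, B, U} x y) : 0 ≤ d * ((B.1 - A.1) * (y - A.2) - (B.2 - A.2) * (x - A.1)) := by
  obtain ⟨f, h1, h2, h3, h4⟩ := hT
  have h0 : (B.1 - A.1) * (U.2 - A.2) - (B.2 - A.2) * (U.1 - A.1) ≠ 0 := by omega
  rw [sum_triple h0] at h2 h3 h4
  have hU := h1 U (by simp)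
  have hdd : (d : ℝ) * d = 1 := by rcases hd with rfl | rfl <;> norm_num
  have h' : ((B.1 : ℝ) - A.1) * (U.2 - A.2) - (B.2 - A.2) * (U.1 - A.1) = d := by exact_mod_cast h
  have : d * (((B.1 : ℝ) - A.1) * (y - A.2) - (B.2 - A.2) * (x - A.1)) = f U := by
    linear_combination (f U * d) * h' + f U * hdd - d * (B.1 - A.1) * h4 + d * (B.2 - A.2) * h3 +
      d * ((B.1 - A.1) * A.2 - (B.2 - A.2) * A.1) * h2
  rw [this]
  exact hU

lemma inOpenTri_of_det {A B U : ℤ × ℤ} {d : ℤ} (hd : d = 1 ∨ d = -1)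
    (h : (B.1 - A.1) * (U.2 - A.2) - (B.2 - A.2) * (U.1 - A.1) = d) {x y : ℝ}
    (hU : 0 < d * (((B.1 : ℝ) - A.1) * (y - A.2) - (B.2 - A.2) * (x - A.1)))
    (hB : 0 < d * ((x - A.1) * ((U.2 : ℝ) - A.2) - (y - A.2) * (U.1 - A.1)))
    (hA : d * (((B.1 : ℝ) - A.1) * (y - A.2) - (B.2 - A.2) * (x - A.1)) +
      d * ((x - A.1) * ((U.2 : ℝ) - A.2) - (y - A.2) * (U.1 - A.1)) < 1) :
    InOpenTri {A, B, U} x y := by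
  have h0 : (B.1 - A.1) * (U.2 - A.2) - (B.2 - A.2) * (U.1 - A.1) ≠ 0 := by omega
  have hdd : (d : ℝ) * d = 1 := by rcases hd with rfl | rfl <;> norm_num
  have h' : ((B.1 : ℝ) - A.1) * (U.2 - A.2) - (B.2 - A.2) * (U.1 - A.1) = d := by exact_mod_cast h
  have hBA : B ≠ A := by
    rintro rfl
    apply h0
    ring
  have hUA : U ≠ A := by
    rintro rfl
    apply h0
    ring
  have hUB : U ≠ B := by
    rintro rfl
    apply h0
    ring
  refine ⟨fun v => if v = A then 1 - d * (((B.1 : ℝ) - A.1) * (y - A.2) - (B.2 - A.2) * (x - A.1)) -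
      d * ((x - A.1) * ((U.2 : ℝ) - A.2) - (y - A.2) * (U.1 - A.1)) else if v = B then
      d * ((x - A.1) * ((U.2 : ℝ) - A.2) - (y - A.2) * (U.1 - A.1)) else
      d * (((B.1 : ℝ) - A.1) * (y - A.2) - (B.2 - A.2) * (x - A.1)), ?_, ?_, ?_, ?_⟩
  · intro v _
    dsimp only
    split_ifs <;> linarith
  all_goals
    rw [sum_triple h0]
    simp only [if_true, hBA, hUA, hUB, if_false]
  · ring
  · linear_combination (d * (x - A.1)) * h' + (x - A.1) * hdd
  · linear_combination (d * (y - A.2)) * h' + (y - A.2) * hdd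

/-- Near an inner point of the edge `A B`, the points on the side of `U` are in the open triangle. -/
lemma eventually_inOpenTri {A B U : ℤ × ℤ} {d : ℤ} (hd : d = 1 ∨ d = -1)
    (h : (B.1 - A.1) * (U.2 - A.2) - (B.2 - A.2) * (U.1 - A.1) = d) {X Y : ℝ → ℝ}
    (hX : Continuous X) (hY : Continuous Y) {t₁ μ : ℝ} (h0 : 0 < μ) (h1 : μ < 1)
    (hx : X t₁ = A.1 + μ * (B.1 - A.1)) (hy : Y t₁ = A.2 + μ * (B.2 - A.2)) :
    ∀ᶠ t in nhds t₁, 0 < d * (((B.1 : ℝ) - A.1) * (Y t - A.2) - (B.2 - A.2) * (X t - A.1)) →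
      InOpenTri {A, B, U} (X t) (Y t) := by
  have hdd : (d : ℝ) * d = 1 := by rcases hd with rfl | rfl <;> norm_num
  have h' : ((B.1 : ℝ) - A.1) * (U.2 - A.2) - (B.2 - A.2) * (U.1 - A.1) = d := by exact_mod_cast h
  -- At an inner point of the edge the weights at `A` and `B` are positive and stay so nearby; only
  -- the weight at `U` has to be assumed positive.
  have e1 : ∀ᶠ t in nhds t₁, 0 < d * ((X t - A.1) * ((U.2 : ℝ) - A.2) -
      (Y t - A.2) * (U.1 - A.1)) := by
    refine ContinuousAt.eventually_lt continuousAt_const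
      (g := fun t => d * ((X t - A.1) * ((U.2 : ℝ) - A.2) - (Y t - A.2) * (U.1 - A.1)))
      (by fun_prop) ?_
    rw [hx, hy]
    have : d * ((A.1 + μ * (B.1 - A.1) - A.1) * ((U.2 : ℝ) - A.2) -
      (A.2 + μ * (B.2 - A.2) - A.2) * (U.1 - A.1)) = μ := by
      linear_combination (d * μ) * h' + μ * hdd
    rw [this]
    exact h0
  have e2 : ∀ᶠ t in nhds t₁, d * (((B.1 : ℝ) - A.1) * (Y t - A.2) - (B.2 - A.2) * (X t - A.1)) +
      d * ((X t - A.1) * ((U.2 : ℝ) - A.2) - (Y t - A.2) * (U.1 - A.1)) < 1 := by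
    refine ContinuousAt.eventually_lt
      (f := fun t => d * (((B.1 : ℝ) - A.1) * (Y t - A.2) - (B.2 - A.2) * (X t - A.1)) +
      d * ((X t - A.1) * ((U.2 : ℝ) - A.2) - (Y t - A.2) * (U.1 - A.1)))
      (by fun_prop) continuousAt_const ?_
    rw [hx, hy]
    have : d * (((B.1 : ℝ) - A.1) * (A.2 + μ * (B.2 - A.2) - A.2) -
      (B.2 - A.2) * (A.1 + μ * (B.1 - A.1) - A.1)) +
      d * ((A.1 + μ * (B.1 - A.1) - A.1) * ((U.2 : ℝ) - A.2) -
      (A.2 + μ * (B.2 - A.2) - A.2) * (U.1 - A.1)) = μ := by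
      linear_combination (d * μ) * h' + μ * hdd
    rw [this]
    exact h1
  filter_upwards [e1, e2] with t h3 h4 h5
  exact inOpenTri_of_det hd h h5 h3 h4

lemma continuous_curveX (m n k : ℕ) (δ : ℝ) : Continuous (curveX m n k δ) := by
  unfold curveX
  fun_prop

lemma continuous_curveY (m n k : ℕ) (δ : ℝ) : Continuous (curveY m n k δ) := by
  unfold curveY
  fun_prop

/-! ### Crossing times -/

section crossing

variable {X Y : ℝ → ℝ} {N : ℕ} {τ : ℕ → Finset (ℤ × ℤ)} {t : ℕ → ℝ}

lemma PlaneCrossing.mono (h : PlaneCrossing X Y N τ t) {i j : ℕ} (hij : i ≤ j) (hj : j ≤ N + 1) :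
    t i ≤ t j := by
  induction j, hij using Nat.le_induction with
  | base => exact le_rfl
  | succ j _ ih => exact (ih (by omega)).trans (h.lt j (by omega)).le

lemma PlaneCrossing.strictMono (h : PlaneCrossing X Y N τ t) {i j : ℕ} (hij : i < j)
    (hj : j ≤ N + 1) : t i < t j :=
  (h.lt i (by omega)).trans_le (h.mono hij hj)

lemma PlaneCrossing.pos (h : PlaneCrossing X Y N τ t) {j : ℕ} (hj : j < N) : 0 < t (j + 1) :=
  h.zero ▸ h.strictMono (Nat.succ_pos j) (by omega)

lemma PlaneCrossing.lt_one (h : PlaneCrossing X Y N τ t) {j : ℕ} (hj : j < N) : t (j + 1) < 1 :=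
  h.one ▸ h.strictMono (by omega) le_rfl

lemma PlaneCrossing.exists_index (h : PlaneCrossing X Y N τ t) {x : ℝ} (h0 : 0 ≤ x) (h1 : x ≤ 1) :
    ∃ i ≤ N, x ∈ Set.Icc (t i) (t (i + 1)) := by
  have key : ∀ j ≤ N, x ≤ t (j + 1) → ∃ i ≤ N, x ∈ Set.Icc (t i) (t (i + 1)) := by
    intro j
    induction j with
    | zero => exact fun _ hx => ⟨0, Nat.zero_le _, by rw [h.zero]; exact h0, hx⟩
    | succ j ih =>
      intro hj hx
      rcases le_total x (t (j + 1)) with h2 | h2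
      · exact ih (by omega) h2
      · exact ⟨j + 1, hj, h2, hx⟩
  exact key N le_rfl (by rw [h.one]; exact h1)

lemma PlaneCrossing.mem_left (h : PlaneCrossing X Y N τ t) {j : ℕ} (hj : j < N) :
    InTri (τ j) (X (t (j + 1))) (Y (t (j + 1))) :=
  h.mem j hj.le _ ⟨(h.lt j hj.le).le, le_rfl⟩

lemma PlaneCrossing.mem_right (h : PlaneCrossing X Y N τ t) {j : ℕ} (hj : j < N) :
    InTri (τ (j + 1)) (X (t (j + 1))) (Y (t (j + 1))) :=
  h.mem (j + 1) hj _ ⟨le_rfl, (h.lt (j + 1) hj).le⟩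

end crossing

/-! ### Edges with both ends on the left of the ray -/

/-- If a parabola `b = δ a (1 - a)` passes below the ends of a segment above the `a`-axis and meets
the segment, then it meets it at both roots. -/
lemma parabola_second_root {aA bA aB bB δ t₀ μ : ℝ} (hδ : 0 < δ) (hbA : 0 < bA) (hbB : 0 < bB)
    (hA : δ * (aA * (1 - aA)) < bA) (hB : δ * (aB * (1 - aB)) < bB) (hμ0 : 0 < μ) (hμ1 : μ < 1)
    (ha : t₀ = aA + μ * (aB - aA)) (hb : δ * (t₀ * (1 - t₀)) = bA + μ * (bB - bA)) :
    aB - aA ≠ 0 ∧ ∃ t₁ ν : ℝ, 0 < ν ∧ ν < 1 ∧ 0 < t₁ ∧ t₁ < 1 ∧ t₁ = aA + ν * (aB - aA) ∧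
      δ * (t₁ * (1 - t₁)) = bA + ν * (bB - bA) ∧
      ∀ t, (aB - aA) * (δ * (t * (1 - t)) - bA) - (bB - bA) * (t - aA) =
        -(δ * (aB - aA)) * ((t - t₀) * (t - t₁)) := by
  subst ha
  have hne : aB - aA ≠ 0 := by
    intro h
    have e : aB = aA := by linarith
    subst e
    nlinarith
  refine ⟨hne, ?_⟩
  -- The height of the segment above the parabola, at parameter `s`, is `c (s - μ) (s - ν)`. Its
  -- value `q = c μ ν` at `s = 0` defines `ν > 0`, and its positive value `c (1 - μ) (1 - ν)` at `s
  -- = 1` forces `ν < 1`.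
  obtain ⟨c, hc⟩ : ∃ c, c = δ * (aB - aA) ^ 2 := ⟨_, rfl⟩
  have hcpos : 0 < c := by rw [hc]; positivity
  obtain ⟨q, hq⟩ : ∃ q, q = bA - δ * (aA * (1 - aA)) := ⟨_, rfl⟩
  have hqpos : 0 < q := by linarith
  obtain ⟨ν, hν0, hνe⟩ : ∃ ν, 0 < ν ∧ ν * (c * μ) = q :=
    ⟨q / (c * μ), by positivity, div_mul_cancel₀ _ (by positivity)⟩
  have hlast : bB - δ * (aB * (1 - aB)) = c * ((1 - μ) * (1 - ν)) := by
    apply mul_left_cancel₀ hμ0.ne'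
    linear_combination -hb + (1 - μ) * hνe - μ * (1 - μ) * hc + (1 - μ) * hq
  have hν1 : ν < 1 := by
    by_contra hcon
    have : c * ((1 - μ) * (1 - ν)) ≤ 0 :=
      mul_nonpos_of_nonneg_of_nonpos hcpos.le
        (mul_nonpos_of_nonneg_of_nonpos (by linarith) (by linarith))
    linarith
  have hbν : δ * ((aA + ν * (aB - aA)) * (1 - (aA + ν * (aB - aA)))) = bA + ν * (bB - bA) := by
    linear_combination -ν * hlast - ν * (1 - ν) * hc + (1 - ν) * hνe + (1 - ν) * hq
  have hpos : 0 < (aA + ν * (aB - aA)) * (1 - (aA + ν * (aB - aA))) := by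
    have : 0 < δ * ((aA + ν * (aB - aA)) * (1 - (aA + ν * (aB - aA)))) := by
      rw [hbν]
      nlinarith
    exact (mul_pos_iff_of_pos_left hδ).1 this
  refine ⟨aA + ν * (aB - aA), ν, hν0, hν1, ?_, ?_, rfl, hbν, ?_⟩
  · nlinarith
  · nlinarith
  · intro t
    obtain ⟨s, rfl⟩ : ∃ s, t = aA + s * (aB - aA) :=
      ⟨(t - aA) / (aB - aA), by rw [div_mul_cancel₀ _ hne]; ring⟩
    linear_combination (-(aB - aA)) * (s * hlast + s * (1 - μ) * (1 - ν) * hc -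
      (1 - s) * (hνe - μ * ν * hc + hq))

section curve

variable {m n k : ℕ} {δ : ℝ}

/-- The coordinate of a point along the segment from `0` to `k (m, n)`. -/
noncomputable def alongCoord (m n k : ℕ) (v : ℤ × ℤ) : ℝ :=
  ((2 * m + n) * v.1 + (m + 2 * n) * v.2) / (2 * (m ^ 2 + m * n + n ^ 2) * k)

/-- The coordinate of a point across the segment from `0` to `k (m, n)`. -/
noncomputable def acrossCoord (m n k : ℕ) (v : ℤ × ℤ) : ℝ :=
  slopeForm m n v / (2 * (m ^ 2 + m * n + n ^ 2) * k)

lemma normForm_pos (hmn : 0 < m + n) : (0 : ℝ) < m ^ 2 + m * n + n ^ 2 := by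
  rcases Nat.eq_zero_or_pos m with rfl | hm
  · have : 0 < n := by omega
    positivity
  · positivity

/-- Inverts the change of coordinates in which the curve is the parabola `b = δ a (1 - a)`,
parametrized by `a`. -/
lemma fst_eq_coords (hmn : 0 < m + n) (hk : 0 < k) (v : ℤ × ℤ) :
    (v.1 : ℝ) = k * (m * alongCoord m n k v - (m + 2 * n) * acrossCoord m n k v) := by
  have h := (normForm_pos hmn).ne'
  have : (k : ℝ) ≠ 0 := by positivity
  simp only [alongCoord, acrossCoord, slopeForm]
  push_cast
  generalize hQ : (m : ℝ) ^ 2 + m * n + n ^ 2 = Q at *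
  field_simp
  rw [← hQ]
  ring

lemma snd_eq_coords (hmn : 0 < m + n) (hk : 0 < k) (v : ℤ × ℤ) :
    (v.2 : ℝ) = k * (n * alongCoord m n k v + (2 * m + n) * acrossCoord m n k v) := by
  have h := (normForm_pos hmn).ne'
  have : (k : ℝ) ≠ 0 := by positivity
  simp only [alongCoord, acrossCoord, slopeForm]
  push_cast
  generalize hQ : (m : ℝ) ^ 2 + m * n + n ^ 2 = Q at *
  field_simp
  rw [← hQ]
  ring

lemma curve_slopeForm (t : ℝ) : m * curveY m n k δ t - n * curveX m n k δ t =
    2 * (m ^ 2 + m * n + n ^ 2) * k * (δ * (t * (1 - t))) := by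
  simp only [curveX, curveY]
  ring

lemma curve_along (t : ℝ) : (2 * m + n) * curveX m n k δ t + (m + 2 * n) * curveY m n k δ t =
    2 * (m ^ 2 + m * n + n ^ 2) * k * t := by
  simp only [curveX, curveY]
  ring

/-- Lattice points on the left of the ray lie above the curve. -/
lemma CurveFree.lt_across (hfree : CurveFree m n k δ) (hmn : 0 < m + n) (hk : 0 < k) (hδ : 0 < δ)
    {v : ℤ × ℤ} (hv : 0 < slopeForm m n v) :
    δ * (alongCoord m n k v * (1 - alongCoord m n k v)) < acrossCoord m n k v := by
  have hQ := normForm_pos hmn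
  have hb : 0 < acrossCoord m n k v := by
    unfold acrossCoord
    positivity
  by_contra! hcon
  have hpos : 0 < alongCoord m n k v * (1 - alongCoord m n k v) :=
    (mul_pos_iff_of_pos_left hδ).1 (hb.trans_le hcon)
  have h0 : 0 < alongCoord m n k v := by nlinarith
  have h1 : alongCoord m n k v < 1 := by nlinarith
  -- A left lattice point on or below the parabola lies on the curve whose bend is scaled by this
  -- ratio, at most `1`.
  have hr : acrossCoord m n k v / (δ * (alongCoord m n k v * (1 - alongCoord m n k v))) * δ *
      (alongCoord m n k v * (1 - alongCoord m n k v)) = acrossCoord m n k v := by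
    rw [mul_assoc]
    exact div_mul_cancel₀ _ (mul_pos hδ hpos).ne'
  refine hfree _ h0 h1 (acrossCoord m n k v /
    (δ * (alongCoord m n k v * (1 - alongCoord m n k v)))) (by positivity)
    ((div_le_one (by positivity)).2 hcon) v ⟨?_, ?_⟩
  · rw [fst_eq_coords hmn hk v, curveX]
    linear_combination (-(k : ℝ) * (m + 2 * n)) * hr
  · rw [snd_eq_coords hmn hk v, curveY]
    linear_combination ((k : ℝ) * (2 * m + n)) * hr

variable {N : ℕ} {τ : ℕ → Finset (ℤ × ℤ)} {t : ℕ → ℝ}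

/-- The form interpolates linearly along an edge and is positive on the interior of the curve, so a
crossed edge has an end on the left. -/
lemma slopeForm_add_pos_of_mem (hmn : 0 < m + n) (hk : 0 < k) (hδ : 0 < δ) {x μ : ℝ}
    (h0 : 0 < x) (h1 : x < 1) {A B : ℤ × ℤ}
    (hx : curveX m n k δ x = A.1 + μ * (B.1 - A.1)) (hy : curveY m n k δ x = A.2 + μ * (B.2 - A.2)) :
    (1 - μ) * slopeForm m n A + μ * slopeForm m n B =
      2 * (m ^ 2 + m * n + n ^ 2) * k * (δ * (x * (1 - x))) ∧
    0 < (1 - μ) * (slopeForm m n A : ℝ) + μ * slopeForm m n B := by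
  have e : (1 - μ) * (slopeForm m n A : ℝ) + μ * slopeForm m n B =
      2 * (m ^ 2 + m * n + n ^ 2) * k * (δ * (x * (1 - x))) := by
    rw [← curve_slopeForm, hx, hy]
    simp only [slopeForm]
    push_cast
    ring
  refine ⟨e, ?_⟩
  rw [e]
  have := normForm_pos hmn
  have : 0 < 1 - x := by linarith
  positivity

/-- Along a crossing without repeated triangles, no crossed edge has both ends on the left. -/
lemma PlaneCrossing.mixed_of_injective (C : PlaneCrossing (curveX m n k δ) (curveY m n k δ) N τ t)
    (hfree : CurveFree m n k δ) (hmn : 0 < m + n) (hk : 0 < k) (hδ : 0 < δ)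
    (hinj : ∀ i j, i < j → j ≤ N → τ i ≠ τ j) {j : ℕ} (hj : j < N) {A B U : ℤ × ℤ}
    (hE : SharedEdge (τ j) (τ (j + 1)) (curveX m n k δ (t (j + 1))) (curveY m n k δ (t (j + 1)))
      A B U) (hB : 0 < slopeForm m n B) : slopeForm m n A ≤ 0 := by
  by_contra! hA
  obtain ⟨hT, hT', hdet, μ, hμ0, hμ1, hx, hy⟩ := hE
  have hQ := normForm_pos hmn
  have hkk : (0 : ℝ) < k := by exact_mod_cast hk
  have hA' := hfree.lt_across hmn hk hδ hA
  have hB' := hfree.lt_across hmn hk hδ hB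
  have hposA : 0 < acrossCoord m n k A := by unfold acrossCoord; positivity
  have hposB : 0 < acrossCoord m n k B := by unfold acrossCoord; positivity
  have A1 := fst_eq_coords hmn hk A
  have A2 := snd_eq_coords hmn hk A
  have B1 := fst_eq_coords hmn hk B
  have B2 := snd_eq_coords hmn hk B
  have s1 := curve_slopeForm (m := m) (n := n) (k := k) (δ := δ) (t (j + 1))
  have s2 := curve_along (m := m) (n := n) (k := k) (δ := δ) (t (j + 1))
  rw [hx, hy] at s1 s2
  have hQk : (2 * ((m : ℝ) ^ 2 + m * n + n ^ 2) * k) ≠ 0 := by positivity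
  set aA := alongCoord m n k A
  set bA := acrossCoord m n k A
  set aB := alongCoord m n k B
  set bB := acrossCoord m n k B
  have hat : t (j + 1) = aA + μ * (aB - aA) := by
    apply mul_left_cancel₀ hQk
    rw [← s2, A1, A2, B1, B2]
    ring
  have hbt : δ * (t (j + 1) * (1 - t (j + 1))) = bA + μ * (bB - bA) := by
    apply mul_left_cancel₀ hQk
    rw [← s1, A1, A2, B1, B2]
    ring
  obtain ⟨hne, t₁, ν, hν0, hν1, ht0, ht1, ha1, hb1, hquad⟩ :=
    parabola_second_root hδ hposA hposB hA' hB' hμ0 hμ1 hat hbt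
  set c : ℝ := -(2 * (m ^ 2 + m * n + n ^ 2) * k ^ 2 * (δ * (aB - aA))) with hc
  have hc0 : c ≠ 0 := by
    rw [hc, neg_ne_zero]
    positivity
  -- The side of the line `A B` on which the curve runs is the sign of a quadratic with the roots `t
  -- (j + 1)` and `t₁`.
  have hG : ∀ x, ((B.1 : ℝ) - A.1) * (curveY m n k δ x - A.2) -
      (B.2 - A.2) * (curveX m n k δ x - A.1) = c * ((x - t (j + 1)) * (x - t₁)) := by
    intro x
    have := hquad x
    rw [A1, A2, B1, B2, hc, curveX, curveY]
    linear_combination (2 * (m ^ 2 + m * n + n ^ 2) * (k : ℝ) ^ 2) * this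
  have hx1 : curveX m n k δ t₁ = A.1 + ν * (B.1 - A.1) := by
    rw [A1, B1, curveX]
    linear_combination (k * m : ℝ) * ha1 - (k * (m + 2 * n) : ℝ) * hb1
  have hy1 : curveY m n k δ t₁ = A.2 + ν * (B.2 - A.2) := by
    rw [A2, B2, curveY]
    linear_combination (k * n : ℝ) * ha1 + (k * (2 * m + n) : ℝ) * hb1
  obtain ⟨d, hd, hdet⟩ : ∃ d : ℤ, (d = 1 ∨ d = -1) ∧
      (B.1 - A.1) * (U.2 - A.2) - (B.2 - A.2) * (U.1 - A.1) = d := ⟨_, hdet, rfl⟩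
  have hd' : -d = 1 ∨ -d = -1 := by omega
  have hdet' : (B.1 - A.1) * ((A + B - U).2 - A.2) - (B.2 - A.2) * ((A + B - U).1 - A.1) = -d := by
    simp only [Prod.fst_sub, Prod.fst_add, Prod.snd_sub, Prod.snd_add]
    linear_combination -hdet
  have hd0 : (d : ℝ) ≠ 0 := by rcases hd with rfl | rfl <;> norm_num
  have hl := C.lt j hj.le
  have hr := C.lt (j + 1) hj
  have hleft : ∀ x ∈ Set.Icc (t j) (t (j + 1)), 0 ≤ d * (c * ((x - t (j + 1)) * (x - t₁))) := by
    intro x hx'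
    rw [← hG]
    exact inTri_det hd hdet (hT ▸ C.mem j hj.le x hx')
  have hright : ∀ x ∈ Set.Icc (t (j + 1)) (t (j + 1 + 1)),
      0 ≤ (-d : ℤ) * (c * ((x - t (j + 1)) * (x - t₁))) := by
    intro x hx'
    rw [← hG]
    exact inTri_det hd' hdet' (hT' ▸ C.mem (j + 1) hj x hx')
  have hdc0 : d * c ≠ 0 := mul_ne_zero hd0 hc0
  -- Outside the two roots the curve is on one side of the edge. If `t₁` is earlier, the curve was
  -- in `τ (j + 1)` just before `t₁`; if later, it is in `τ j` again just after `t₁`. A double root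
  -- would keep it on one side, although the two triangles lie on opposite sides.
  rcases lt_trichotomy t₁ (t (j + 1)) with hlt | heq | hgt
  · have hdc : 0 < (-d : ℤ) * c := by
      have h := hright _ ⟨hr.le, le_rfl⟩
      have h' : 0 < (t (j + 1 + 1) - t (j + 1)) * (t (j + 1 + 1) - t₁) :=
        mul_pos (by linarith) (by linarith)
      rw [← mul_assoc] at h
      refine lt_of_le_of_ne (nonneg_of_mul_nonneg_left h h') ?_
      push_cast
      rw [neg_mul]
      exact (neg_ne_zero.2 hdc0).symm
    have hev := eventually_inOpenTri hd' hdet' (continuous_curveX m n k δ)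
      (continuous_curveY m n k δ) hν0 hν1 hx1 hy1
    obtain ⟨x, ⟨h3, hx0⟩, hx2⟩ := (((hev.filter_mono nhdsWithin_le_nhds).and
      (nhdsWithin_le_nhds (Ioi_mem_nhds ht0))).and (self_mem_nhdsWithin (s := Set.Iio t₁))).exists
    have hx2 : x < t₁ := hx2
    have hx0 : 0 < x := hx0
    have hopen := h3 (by
      rw [hG, ← mul_assoc]
      exact mul_pos hdc (mul_pos_of_neg_of_neg (by linarith) (by linarith)))
    rw [← hT'] at hopen
    obtain ⟨i, hi, hxi⟩ := C.exists_index hx0.le (by linarith)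
    have hij : i < j + 1 := by
      by_contra! hcon
      have := C.mono hcon (by omega)
      linarith [hxi.1]
    exact hinj i (j + 1) hij hj
      (hopen.eq (C.tri _ hj) (C.tri _ hi) (C.mem i hi x hxi)).symm
  · subst heq
    have h1 := hleft _ ⟨le_rfl, hl.le⟩
    have h2 := hright _ ⟨hr.le, le_rfl⟩
    rw [← mul_assoc] at h1 h2
    have h3 := nonneg_of_mul_nonneg_left h1 (mul_pos_of_neg_of_neg (by linarith) (by linarith))
    have h4 := nonneg_of_mul_nonneg_left h2 (mul_pos (by linarith) (by linarith))
    push_cast at h4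
    exact hdc0 (by linarith)
  · have hdc : 0 < d * c := by
      have h := hleft _ ⟨le_rfl, hl.le⟩
      have h' : 0 < (t j - t (j + 1)) * (t j - t₁) :=
        mul_pos_of_neg_of_neg (by linarith) (by linarith)
      rw [← mul_assoc] at h
      exact lt_of_le_of_ne (nonneg_of_mul_nonneg_left h h') hdc0.symm
    have hev := eventually_inOpenTri hd hdet (continuous_curveX m n k δ)
      (continuous_curveY m n k δ) hν0 hν1 hx1 hy1
    obtain ⟨x, ⟨h3, hx0⟩, hx2⟩ := (((hev.filter_mono nhdsWithin_le_nhds).and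
      (nhdsWithin_le_nhds (Iio_mem_nhds ht1))).and (self_mem_nhdsWithin (s := Set.Ioi t₁))).exists
    have hx2 : t₁ < x := hx2
    have hx0 : x < 1 := hx0
    have hopen := h3 (by
      rw [hG, ← mul_assoc]
      exact mul_pos hdc (mul_pos (by linarith) (by linarith)))
    rw [← hT] at hopen
    obtain ⟨i, hi, hxi⟩ := C.exists_index (x := x) (by linarith) hx0.le
    have hij : j < i := by
      by_contra! hcon
      have := C.mono (show i + 1 ≤ j + 1 by omega) (by omega)
      linarith [hxi.2]
    exact hinj j i hij hi (hopen.eq (C.tri _ hj.le) (C.tri _ hi) (C.mem i hi x hxi))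

end curve

/-! ### The first triangle -/

/-- The six triangles around `0` are grouped by whether they contain `1` or `ω`. -/
lemma IsEisTriangle.of_zero_mem {T : Finset (ℤ × ℤ)} (hT : IsEisTriangle T) (h0 : (0, 0) ∈ T) :
    (T = {(0, 0), (0, 1), (1, 0)} ∨ T = {(0, 0), (-1, 1), (0, 1)} ∨ T = {(0, 0), (1, 0), (1, -1)}) ∨
    T = {(0, 0), (-1, 0), (-1, 1)} ∨ T = {(0, 0), (-1, 0), (0, -1)} ∨
    T = {(0, 0), (0, -1), (1, -1)} := by
  obtain ⟨⟨a, b⟩, σ, hσ, rfl⟩ := isEisTriangle_iff.1 hT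
  simp only [tri, Finset.mem_insert, Finset.mem_singleton, Prod.mk.injEq] at h0
  rcases h0 with ⟨h1, h2⟩ | ⟨h1, h2⟩ | ⟨h1, h2⟩ <;> rcases hσ with rfl | rfl
  · obtain ⟨rfl, rfl⟩ : a = 0 ∧ b = 0 := by omega
    decide
  · obtain ⟨rfl, rfl⟩ : a = 0 ∧ b = 0 := by omega
    decide
  · obtain ⟨rfl, rfl⟩ : a = -1 ∧ b = 0 := by omega
    decide
  · obtain ⟨rfl, rfl⟩ : a = 1 ∧ b = 0 := by omega
    decide
  · obtain ⟨rfl, rfl⟩ : a = 0 ∧ b = -1 := by omega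
    decide
  · obtain ⟨rfl, rfl⟩ : a = 0 ∧ b = 1 := by omega
    decide

/-- The other three triangles at `0` have two unlabelled vertices, so the rule cannot be applied to
them. -/
lemma FareyAlong.first {e₀ e₁ e₂ : ℤ × ℤ} {N : ℕ} {τ : ℕ → Finset (ℤ × ℤ)} {L : ℤ × ℤ → ℤ × ℤ}
    (h : FareyAlong e₀ e₁ e₂ N τ L) (hT : IsEisTriangle (τ 0)) (h0 : (0, 0) ∈ τ 0) :
    τ 0 = {(0, 0), (0, 1), (1, 0)} ∨ τ 0 = {(0, 0), (-1, 1), (0, 1)} ∨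
      τ 0 = {(0, 0), (1, 0), (1, -1)} := by
  rcases hT.of_zero_mem h0 with h1 | h1
  · exact h1
  · exfalso
    rcases h.label_step 0 (Nat.zero_le _) with ⟨-, h2⟩ | ⟨v, h2, -⟩
    · rcases h1 with h1 | h1 | h1 <;> rw [h1] at h2 <;> exact absurd h2 (by decide)
    · have h3 := congrArg Finset.card h2
      rw [Finset.card_singleton, labelledBefore, Finset.range_zero, Finset.biUnion_empty] at h3
      rcases h1 with h1 | h1 | h1 <;> rw [h1] at h3 <;> exact absurd h3 (by decide)

/-- As `0` lies on the ray and is not on the exit edge, this edge is the side opposite to `0`; its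
being mixed selects the triangle according to `m`. -/
lemma mixed_start {m n : ℕ} {T T' : Finset (ℤ × ℤ)} {A B U : ℤ × ℤ}
    (h0 : T = {(0, 0), (0, 1), (1, 0)} ∨ T = {(0, 0), (-1, 1), (0, 1)} ∨
      T = {(0, 0), (1, 0), (1, -1)})
    (hT : T = {A, B, U}) (hT' : T' = {A, B, A + B - U}) (hA : slopeForm m n A ≤ 0)
    (hB : 0 < slopeForm m n B) (hA0 : A ≠ (0, 0)) :
    (0 < m ∧ T = {(0, 0), (0, 1), (1, 0)} ∧ T' = {(1, 0), (0, 1), (1, 1)}) ∨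
    (m = 0 ∧ T = {(0, 0), (-1, 1), (0, 1)} ∧ T' = {(0, 1), (-1, 1), (-1, 2)}) := by
  have mA : A ∈ T := hT ▸ by simp
  have mB : B ∈ T := hT ▸ by simp
  have m0 : (0, 0) ∈ T := by rcases h0 with h0 | h0 | h0 <;> rw [h0] <;> simp
  have hB0 : B ≠ (0, 0) := by
    rintro rfl
    simp [slopeForm] at hB
  have hU : U = (0, 0) := by
    rw [hT] at m0
    simp only [Finset.mem_insert, Finset.mem_singleton] at m0
    exact ((m0.resolve_left hA0.symm).resolve_left hB0.symm).symm
  subst hU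
  rcases h0 with h0 | h0 | h0 <;> rw [h0] at mA mB <;>
    simp only [Finset.mem_insert, Finset.mem_singleton] at mA mB
  · rcases mA.resolve_left hA0 with rfl | rfl <;> rcases mB.resolve_left hB0 with rfl | rfl <;>
      simp [slopeForm] at hA hB
    all_goals first
      | omega
      | exact Or.inl ⟨hB, h0, hT'.trans (by decide)⟩
  · rcases mA.resolve_left hA0 with rfl | rfl <;> rcases mB.resolve_left hB0 with rfl | rfl <;>
      simp [slopeForm] at hA hB
    all_goals first
      | omega
      | exact Or.inr ⟨hA, h0, hT'.trans (by decide)⟩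
  · rcases mB.resolve_left hB0 with rfl | rfl <;> simp [slopeForm] at hB <;> omega

section curve

variable {m n k N : ℕ} {δ : ℝ} {τ : ℕ → Finset (ℤ × ℤ)} {t : ℕ → ℝ}

lemma PlaneCrossing.zero_mem (C : PlaneCrossing (curveX m n k δ) (curveY m n k δ) N τ t) :
    (0, 0) ∈ τ 0 := by
  apply mem_of_inTri (C.tri 0 (Nat.zero_le _))
  have := C.mem 0 (Nat.zero_le _) (t 0) ⟨le_rfl, (C.lt 0 (Nat.zero_le _)).le⟩
  rw [C.zero] at this
  simpa [curveX, curveY] using this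

lemma PlaneCrossing.end_mem (C : PlaneCrossing (curveX m n k δ) (curveY m n k δ) N τ t) :
    ((k * m : ℤ), (k * n : ℤ)) ∈ τ N := by
  apply mem_of_inTri (C.tri N le_rfl)
  have := C.mem N le_rfl (t (N + 1)) ⟨(C.lt N le_rfl).le, le_rfl⟩
  rw [C.one] at this
  simpa [curveX, curveY] using this

lemma PlaneCrossing.length_pos (C : PlaneCrossing (curveX m n k δ) (curveY m n k δ) N τ t)
    (hmn : 0 < m + n) (hk : 2 ≤ k) : 0 < N := by
  rcases Nat.eq_zero_or_pos N with rfl | h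
  · exfalso
    have h1 := C.end_mem
    have hm : 0 < m → 2 ≤ (k : ℤ) * m := fun h => by exact_mod_cast Nat.mul_le_mul hk h
    have hn : 0 < n → 2 ≤ (k : ℤ) * n := fun h => by exact_mod_cast Nat.mul_le_mul hk h
    generalize (k : ℤ) * m = x at *
    generalize (k : ℤ) * n = y at *
    rcases (C.tri 0 le_rfl).of_zero_mem C.zero_mem with (h2 | h2 | h2) | h2 | h2 | h2 <;>
    · rw [h2] at h1
      simp only [Finset.mem_insert, Finset.mem_singleton, Prod.mk.injEq] at h1
      omega
  · exact h

lemma PlaneCrossing.exists_edge (C : PlaneCrossing (curveX m n k δ) (curveY m n k δ) N τ t)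
    (hfree : CurveFree m n k δ) (hmn : 0 < m + n) (hk : 0 < k) (hδ : 0 < δ) {j : ℕ} (hj : j < N) :
    ∃ A B U, SharedEdge (τ j) (τ (j + 1)) (curveX m n k δ (t (j + 1)))
      (curveY m n k δ (t (j + 1))) A B U ∧ 0 < slopeForm m n B := by
  obtain ⟨A, B, U, hE⟩ := exists_sharedEdge (C.tri j hj.le) (C.tri (j + 1) hj) (C.ne j hj)
    (C.mem_left hj) (C.mem_right hj) fun v hv =>
      hfree _ (C.pos hj) (C.lt_one hj) 1 one_pos le_rfl v (by simpa using hv)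
  by_cases hB : 0 < slopeForm m n B
  · exact ⟨A, B, U, hE, hB⟩
  · refine ⟨B, A, U, hE.symm, ?_⟩
    obtain ⟨μ, hμ0, hμ1, hx, hy⟩ := hE.mem
    have := (slopeForm_add_pos_of_mem hmn hk hδ (C.pos hj) (C.lt_one hj) hx hy).2
    by_contra hA
    have hA' : (slopeForm m n A : ℝ) ≤ 0 := by exact_mod_cast not_lt.1 hA
    have hB' : (slopeForm m n B : ℝ) ≤ 0 := by exact_mod_cast not_lt.1 hB
    nlinarith

/-- The curve crosses an edge from `0` to a lattice point `B` on its left from left to right. -/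
lemma PlaneCrossing.det_eq_one (C : PlaneCrossing (curveX m n k δ) (curveY m n k δ) N τ t)
    (hN : 0 < N) (hk : 0 < k) {B U : ℤ × ℤ}
    (hE : SharedEdge (τ 0) (τ 1) (curveX m n k δ (t 1)) (curveY m n k δ (t 1)) (0, 0) B U)
    (hB : 0 < slopeForm m n B) : B.1 * U.2 - B.2 * U.1 = 1 := by
  obtain ⟨hT, -, hdet, μ, -, -, hx, hy⟩ := hE
  refine (show _ ∨ _ by simpa using hdet).resolve_right fun hd => ?_
  have h0 : 0 < t 1 := C.pos hN
  have h1 : t 1 < 1 := C.lt_one hN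
  have hin := C.mem 0 (Nat.zero_le _) (t 1 / 2) ⟨by rw [C.zero]; positivity, by simp; linarith⟩
  rw [hT] at hin
  have hge := inTri_det (Or.inr rfl) (by simpa using hd) hin
  have hkk : (0 : ℝ) < k := by exact_mod_cast hk
  have hB' : (0 : ℝ) < m * B.2 - n * B.1 := by
    have : (0 : ℝ) < slopeForm m n B := by exact_mod_cast hB
    simpa [slopeForm] using this
  -- The determinant of `B` and the curve at time `x` is `k x ((1 - x) g - slopeForm m n B)`. It
  -- vanishes at `t 1`, so `g > 0` and the curve is to the left of the line `0 B` before.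
  obtain ⟨g, hg⟩ : ∃ g, g = δ * (B.1 * (2 * m + n) + B.2 * (m + 2 * n)) := ⟨_, rfl⟩
  have e1 : (1 - t 1) * g = m * B.2 - n * B.1 := by
    apply mul_left_cancel₀ (mul_pos hkk h0).ne'
    simp only [curveX, curveY] at hx hy
    push_cast at hx hy
    rw [hg]
    linear_combination (B.1 : ℝ) * hy - B.2 * hx
  have hgpos : 0 < g := by
    rw [← e1] at hB'
    exact (mul_pos_iff_of_pos_left (by linarith)).1 hB'
  have e2 : ((B.1 : ℝ) * curveY m n k δ (t 1 / 2) - B.2 * curveX m n k δ (t 1 / 2)) =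
      k * (t 1 / 2) * (g * (t 1 / 2)) := by
    simp only [curveX, curveY]
    linear_combination k * (t 1 / 2) * e1 - k * (t 1 / 2) * (1 - t 1 / 2) * hg
  have e3 : 0 < k * (t 1 / 2) * (g * (t 1 / 2)) := by positivity
  simp at hge
  linarith

/-- A lattice free crossing that carries a Farey labelling is a mixed path. -/
theorem PlaneCrossing.mixedPath_of_labelled
    (C : PlaneCrossing (curveX m n k δ) (curveY m n k δ) N τ t)
    (hfree : CurveFree m n k δ) (hmn : 0 < m + n) (hk : 2 ≤ k) (hδ : 0 < δ)
    {e₀ e₁ e₂ : ℤ × ℤ} {L : ℤ × ℤ → ℤ × ℤ} (hL : FareyAlong e₀ e₁ e₂ N τ L) :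
    MixedPath m n N τ := by
  have hk0 : 0 < k := by omega
  have hN := C.length_pos hmn hk
  have hinj : ∀ i j, i < j → j ≤ N → τ i ≠ τ j := fun i j => hL.ne
  refine ⟨hN, fun j hj => ?_, fun j hj => hinj _ _ (by omega) hj, ?_⟩
  · obtain ⟨A, B, U, hE, hB⟩ := C.exists_edge hfree hmn hk0 hδ hj
    exact ⟨A, B, U, hE.left_eq, hE.right_eq,
      C.mixed_of_injective hfree hmn hk0 hδ hinj hj hE hB, hB⟩
  · obtain ⟨A, B, U, hE, hB⟩ := C.exists_edge hfree hmn hk0 hδ hN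
    have hA := C.mixed_of_injective hfree hmn hk0 hδ hinj hN hE hB
    have hfirst := hL.first (C.tri 0 (Nat.zero_le _)) C.zero_mem
    refine mixed_start hfirst hE.left_eq hE.right_eq hA hB ?_
    rintro rfl
    have hd := C.det_eq_one hN hk0 hE hB
    have mB : B ∈ τ 0 := hE.left_eq ▸ by simp
    have mU : U ∈ τ 0 := hE.left_eq ▸ by simp
    rcases hfirst with h0 | h0 | h0 <;> rw [h0] at mB mU <;>
      simp only [Finset.mem_insert, Finset.mem_singleton] at mB mU <;>
      rcases mB with rfl | rfl | rfl <;> rcases mU with rfl | rfl | rfl <;>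
      simp [slopeForm] at hB hd
    all_goals try omega
    -- There remains `τ 0 = [0, ω - 1, ω]`, left through the edge from `0` to `ω`; then `τ 1 = [0,
    -- 1, ω]` has no unlabelled vertex.
    rcases hL.label_step 1 hN with ⟨h1, -⟩ | ⟨v, hv, -⟩
    · omega
    · have : v ∈ τ (0 + 1) \ labelledBefore τ 1 := hv ▸ Finset.mem_singleton_self v
      rw [hE.right_eq, Finset.mem_sdiff] at this
      simp [labelledBefore] at this
      tauto

end curve

/-! ### Every curve that meets the lattice lines finitely often crosses a sequence of triangles -/

/-- By connectedness the values stay between consecutive integers, found at the midpoint; the end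
points follow by closure. -/
lemma exists_unit_interval {f : ℝ → ℝ} (hf : Continuous f) {a b : ℝ} (hab : a < b)
    (h : ∀ x ∈ Set.Ioo a b, ∀ i : ℤ, f x ≠ i) :
    ∃ i : ℤ, (∀ x ∈ Set.Ioo a b, i < f x ∧ f x < i + 1) ∧
      ∀ x ∈ Set.Icc a b, i ≤ f x ∧ f x ≤ i + 1 := by
  have hc : (a + b) / 2 ∈ Set.Ioo a b := ⟨by linarith, by linarith⟩
  have hord := (isPreconnected_Ioo.image f hf.continuousOn (s := Set.Ioo a b)).ordConnected
  have hopen : ∀ x ∈ Set.Ioo a b,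
      (⌊f ((a + b) / 2)⌋ : ℝ) < f x ∧ f x < ⌊f ((a + b) / 2)⌋ + 1 := by
    intro x hx
    constructor
    · by_contra! hcon
      obtain ⟨y, hy, hy'⟩ := hord.out (Set.mem_image_of_mem f hx) (Set.mem_image_of_mem f hc)
        ⟨hcon, Int.floor_le _⟩
      exact h y hy _ hy'
    · by_contra! hcon
      obtain ⟨y, hy, hy'⟩ := hord.out (Set.mem_image_of_mem f hc) (Set.mem_image_of_mem f hx)
        ⟨(Int.lt_floor_add_one _).le, hcon⟩
      exact h y hy (⌊f ((a + b) / 2)⌋ + 1) (by push_cast; exact hy')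
  refine ⟨_, hopen, ?_⟩
  have hclosed : IsClosed {x | (⌊f ((a + b) / 2)⌋ : ℝ) ≤ f x ∧ f x ≤ ⌊f ((a + b) / 2)⌋ + 1} :=
    (isClosed_le continuous_const hf).inter (isClosed_le hf continuous_const)
  rw [← closure_Ioo hab.ne]
  exact closure_minimal (fun x hx => ⟨(hopen x hx).1.le, (hopen x hx).2.le⟩) hclosed

/-- The curve meets a lattice line at time `x`. -/
def OnLatticeLine (X Y : ℝ → ℝ) (x : ℝ) : Prop :=
  ∃ i : ℤ, X x = i ∨ Y x = i ∨ X x + Y x = i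

/-- Both coordinates and their sum are confined to unit intervals; the interval of the sum decides
between the two triangles of the unit parallelogram. -/
lemma exists_triangle {X Y : ℝ → ℝ} (hX : Continuous X) (hY : Continuous Y) {a b : ℝ} (hab : a < b)
    (h : ∀ x ∈ Set.Ioo a b, ¬ OnLatticeLine X Y x) :
    ∃ T, IsEisTriangle T ∧ ∀ x ∈ Set.Icc a b, InTri T (X x) (Y x) := by
  obtain ⟨i, hi, hi'⟩ := exists_unit_interval hX hab fun x hx i e => h x hx ⟨i, Or.inl e⟩
  obtain ⟨j, hj, hj'⟩ := exists_unit_interval hY hab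
    fun x hx i e => h x hx ⟨i, Or.inr (Or.inl e)⟩
  obtain ⟨l, hl, hl'⟩ := exists_unit_interval (hX.add hY) hab
    fun x hx i e => h x hx ⟨i, Or.inr (Or.inr e)⟩
  simp only [Pi.add_apply] at hl hl'
  have hc : (a + b) / 2 ∈ Set.Ioo a b := ⟨by linarith, by linarith⟩
  obtain ⟨i1, i2⟩ := hi _ hc
  obtain ⟨j1, j2⟩ := hj _ hc
  obtain ⟨l1, l2⟩ := hl _ hc
  have k1 : i + j < l + 1 := by
    have : ((i + j : ℤ) : ℝ) < (l + 1 : ℤ) := by push_cast; linarith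
    exact_mod_cast this
  have k2 : l < i + j + 2 := by
    have : (l : ℝ) < (i + j + 2 : ℤ) := by push_cast; linarith
    exact_mod_cast this
  rcases (show l = i + j ∨ l = i + j + 1 by omega) with rfl | rfl
  · refine ⟨tri (i, j) 1, isEisTriangle_iff.2 ⟨_, _, Or.inl rfl, rfl⟩, fun x hx => ?_⟩
    obtain ⟨i1, i2⟩ := hi' x hx
    obtain ⟨j1, j2⟩ := hj' x hx
    obtain ⟨l1, l2⟩ := hl' x hx
    rw [inTri_tri (Or.inl rfl)]
    push_cast at *
    refine ⟨?_, ?_, ?_⟩ <;> linarith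
  · refine ⟨tri (i + 1, j + 1) (-1), isEisTriangle_iff.2 ⟨_, _, Or.inr rfl, rfl⟩, fun x hx => ?_⟩
    obtain ⟨i1, i2⟩ := hi' x hx
    obtain ⟨j1, j2⟩ := hj' x hx
    obtain ⟨l1, l2⟩ := hl' x hx
    rw [inTri_tri (Or.inr rfl)]
    push_cast at *
    refine ⟨?_, ?_, ?_⟩ <;> linarith

lemma exists_triangles {X Y : ℝ → ℝ} (hX : Continuous X) (hY : Continuous Y) (s : Finset ℝ) :
    ∀ a b : ℝ, a < b → (∀ x ∈ Set.Ioo a b, OnLatticeLine X Y x → x ∈ s) →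
    ∃ (N : ℕ) (τ : ℕ → Finset (ℤ × ℤ)) (t : ℕ → ℝ), (∀ j ≤ N, IsEisTriangle (τ j)) ∧
      (∀ j < N, τ j ≠ τ (j + 1)) ∧ t 0 = a ∧ t (N + 1) = b ∧ (∀ j ≤ N, t j < t (j + 1)) ∧
      ∀ j ≤ N, ∀ x ∈ Set.Icc (t j) (t (j + 1)), InTri (τ j) (X x) (Y x) := by
  induction s using Finset.induction_on_max with
  | empty =>
    intro a b hab h
    obtain ⟨T, hT, hin⟩ := exists_triangle hX hY hab fun x hx hl => by simpa using h x hx hl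
    refine ⟨0, fun _ => T, fun j => if j = 0 then a else b, fun _ _ => hT, by simp, by simp,
      by simp, ?_, ?_⟩
    · intro j hj
      obtain rfl : j = 0 := by omega
      simpa using hab
    · intro j hj
      obtain rfl : j = 0 := by omega
      simpa using hin
  | insert c s hmax ih =>
    intro a b hab h
    by_cases hc : c ∈ Set.Ioo a b
    · obtain ⟨N, τ, t, h1, h2, h3, h4, h5, h6⟩ := ih a c hc.1 fun x hx hl =>
        (Finset.mem_insert.1 (h x ⟨hx.1, hx.2.trans hc.2⟩ hl)).resolve_left hx.2.ne
      obtain ⟨T, hT, hin⟩ := exists_triangle hX hY hc.2 fun x hx hl => by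
        rcases Finset.mem_insert.1 (h x ⟨hc.1.trans hx.1, hx.2⟩ hl) with e | e
        · exact hx.1.ne' e
        · exact lt_asymm hx.1 (hmax x e)
      -- The curve may only touch a lattice line at the last time `c`; the two adjacent intervals
      -- are then merged.
      by_cases hTN : τ N = T
      · refine ⟨N, τ, Function.update t (N + 1) b, h1, h2, ?_, by simp, ?_, ?_⟩
        · rw [Function.update_of_ne (by omega), h3]
        · intro j hj
          rw [Function.update_of_ne (a := j) (by omega)]
          rcases hj.eq_or_lt with rfl | hj'
          · rw [Function.update_self]
            exact (h5 j le_rfl).trans (h4 ▸ hc.2)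
          · rw [Function.update_of_ne (by omega)]
            exact h5 j hj
        · intro j hj x
          rw [Function.update_of_ne (a := j) (by omega)]
          rcases hj.eq_or_lt with rfl | hj'
          · rw [Function.update_self]
            intro hx
            rcases le_total x c with hxc | hxc
            · exact h6 j le_rfl x ⟨hx.1, h4 ▸ hxc⟩
            · rw [hTN]
              exact hin x ⟨hxc, hx.2⟩
          · rw [Function.update_of_ne (by omega)]
            exact h6 j hj x
      · refine ⟨N + 1, Function.update τ (N + 1) T, Function.update t (N + 1 + 1) b, ?_, ?_, ?_,
          by simp, ?_, ?_⟩
        · intro j hj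
          rcases hj.eq_or_lt with rfl | hj'
          · rwa [Function.update_self]
          · rw [Function.update_of_ne (by omega)]
            exact h1 j (by omega)
        · intro j hj
          rw [Function.update_of_ne (a := j) (by omega)]
          rcases (Nat.lt_succ_iff.1 hj).eq_or_lt with rfl | hj'
          · rwa [Function.update_self]
          · rw [Function.update_of_ne (by omega)]
            exact h2 j hj'
        · rw [Function.update_of_ne (by omega), h3]
        · intro j hj
          rw [Function.update_of_ne (a := j) (by omega)]
          rcases hj.eq_or_lt with rfl | hj'
          · rw [Function.update_self, h4]
            exact hc.2
          · rw [Function.update_of_ne (by omega)]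
            exact h5 j (by omega)
        · intro j hj x
          rw [Function.update_of_ne (a := j) (f := t) (by omega)]
          rcases hj.eq_or_lt with rfl | hj'
          · rw [Function.update_self, Function.update_self, h4]
            exact hin x
          · rw [Function.update_of_ne (by omega), Function.update_of_ne (by omega)]
            exact h6 j (by omega) x
    · exact ih a b hab fun x hx hl =>
        (Finset.mem_insert.1 (h x hx hl)).resolve_left fun e => hc (e ▸ hx)

/-- Boundedness leaves finitely many integer values, each taken at most once. -/
lemma finite_integer_times {f : ℝ → ℝ} (hf : Continuous f)
    (hinj : ∀ x ∈ Set.Ioo (0 : ℝ) 1, ∀ y ∈ Set.Ioo (0 : ℝ) 1, ∀ i : ℤ, f x = i → f y = i → x = y) :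
    {x ∈ Set.Ioo (0 : ℝ) 1 | ∃ i : ℤ, f x = i}.Finite := by
  obtain ⟨M, hM⟩ := (isCompact_Icc (a := (0 : ℝ)) (b := 1)).exists_bound_of_continuousOn
    hf.continuousOn
  refine Set.Finite.of_finite_image (f := f)
    (((Set.finite_Icc (-⌈M⌉) ⌈M⌉).image (fun i : ℤ => (i : ℝ))).subset ?_) ?_
  · rintro _ ⟨x, ⟨hx, i, hi⟩, rfl⟩
    have := abs_le.1 (hM x ⟨hx.1.le, hx.2.le⟩)
    rw [hi] at this
    have hc := Int.le_ceil M
    refine ⟨i, ⟨?_, ?_⟩, hi.symm⟩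
    · have : ((-⌈M⌉ : ℤ) : ℝ) ≤ i := by push_cast; linarith
      exact_mod_cast this
    · have : (i : ℝ) ≤ (⌈M⌉ : ℤ) := by linarith
      exact_mod_cast this
  · rintro x ⟨hx, i, hi⟩ y ⟨hy, -⟩ hxy
    exact hinj x hx y hy i hi (hxy ▸ hi)

/-! ### Slightly bent segments -/

/-- The curve meets every lattice line at most once between its ends, stays to the right of the next
lattice points on its left, and moves away from `0`. -/
structure SlightlyBent (m n k : ℕ) (δ : ℝ) : Prop where
  fst_inj : ∀ x ∈ Set.Ioo (0 : ℝ) 1, ∀ y ∈ Set.Ioo (0 : ℝ) 1, ∀ i : ℤ,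
    curveX m n k δ x = i → curveX m n k δ y = i → x = y
  snd_inj : ∀ x ∈ Set.Ioo (0 : ℝ) 1, ∀ y ∈ Set.Ioo (0 : ℝ) 1, ∀ i : ℤ,
    curveY m n k δ x = i → curveY m n k δ y = i → x = y
  add_inj : ∀ x ∈ Set.Ioo (0 : ℝ) 1, ∀ y ∈ Set.Ioo (0 : ℝ) 1, ∀ i : ℤ,
    curveX m n k δ x + curveY m n k δ x = i → curveX m n k δ y + curveY m n k δ y = i → x = y
  fst_pos : ∀ x ∈ Set.Ioo (0 : ℝ) 1, 0 < m → 0 < curveX m n k δ x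
  add_pos : ∀ x ∈ Set.Ioo (0 : ℝ) 1, 0 < curveX m n k δ x + curveY m n k δ x
  form_lt : 2 * (m ^ 2 + m * n + n ^ 2) * k * δ < 1

lemma mul_one_sub_lt {x : ℝ} (hx : x ∈ Set.Ioo (0 : ℝ) 1) : 0 < x * (1 - x) ∧ x * (1 - x) < 1 := by
  obtain ⟨h0, h1⟩ := hx
  constructor <;> nlinarith

/-- The difference has the factor `a + c (1 - x - y)`, which is positive because `|1 - x - y| < 1`
and `|c| < a`. -/
lemma quadratic_inj {a c x y : ℝ} (hb : -a < c) (hab : c < a) (hx : x ∈ Set.Ioo (0 : ℝ) 1)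
    (hy : y ∈ Set.Ioo (0 : ℝ) 1)
    (h : a * x + c * (x * (1 - x)) = a * y + c * (y * (1 - y))) : x = y := by
  have : (x - y) * (a + c * (1 - x - y)) = 0 := by linear_combination h
  rcases mul_eq_zero.1 this with h1 | h1
  · linarith
  · nlinarith [hx.1, hx.2, hy.1, hy.2]

lemma slightlyBent_of_small {m n k : ℕ} {δ : ℝ} (hmn : 0 < m + n) (hk : 0 < k) (hδ : 0 < δ)
    (hsmall : δ * (4 * k * (m + n + 1) ^ 2) < 1) : SlightlyBent m n k δ := by
  have hk1 : (1 : ℝ) ≤ k := by exact_mod_cast hk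
  have hm0 : (0 : ℝ) ≤ m := by positivity
  have hn0 : (0 : ℝ) ≤ n := by positivity
  have bound : ∀ c : ℝ, c ≤ 4 * k * (m + n + 1) ^ 2 → δ * c < 1 := fun c hc =>
    (mul_le_mul_of_nonneg_left hc hδ.le).trans_lt hsmall
  have hsq : (m + n + 1 : ℝ) ≤ (m + n + 1) ^ 2 := by nlinarith
  have b1 : δ * (k * (m + 2 * n)) < 1 := bound _ (by nlinarith)
  have b2 : δ * (k * (2 * m + n)) < 1 := bound _ (by nlinarith)
  have b3 : δ * (m + 2 * n) < 1 := bound _ (by nlinarith)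
  have b4 : δ * (2 * m + n) < 1 := bound _ (by nlinarith)
  have b5 : δ < 1 := by simpa using bound 1 (by nlinarith)
  have cast_pos : ∀ a : ℕ, 0 < a → (1 : ℝ) ≤ a := fun a ha => by exact_mod_cast ha
  have hmn1 : (1 : ℝ) ≤ m + n := by exact_mod_cast hmn
  have hδm : 0 ≤ δ * m := by positivity
  have hδn : 0 ≤ δ * n := by positivity
  have hs : δ * m + δ * n < m + n := by
    rw [← mul_add]
    exact (mul_lt_iff_lt_one_left (by linarith)).2 b5
  refine ⟨?_, ?_, ?_, ?_, ?_, ?_⟩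
  · intro x hx y hy i h1 h2
    simp only [curveX] at h1 h2
    -- For `m = 0` this coordinate consists of the bend alone and stays strictly between `-1` and
    -- `0`, so no integer is attained.
    rcases Nat.eq_zero_or_pos m with rfl | hm
    · exfalso
      have h3 := mul_one_sub_lt hx
      simp only [Nat.cast_zero, zero_mul, zero_add, zero_sub, mul_neg] at h1 b1
      have hn := cast_pos n (by omega)
      have h4 : 0 < δ * (k * (2 * n)) := by positivity
      have h5 : (i : ℝ) < 0 := by
        rw [← h1]
        have : 0 < δ * (k * (2 * n)) * (x * (1 - x)) := mul_pos h4 h3.1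
        linarith
      have h6 : (-1 : ℝ) < i := by
        rw [← h1]
        nlinarith
      norm_cast at h5 h6
      omega
    · have := cast_pos m hm
      exact quadratic_inj (a := m) (c := -(δ * (m + 2 * n))) (by linarith)
        ((neg_nonpos.2 (by positivity)).trans_lt (by linarith)) hx hy
        (mul_left_cancel₀ (show (k : ℝ) ≠ 0 by positivity) (by linear_combination h1 - h2))
  · intro x hx y hy i h1 h2
    simp only [curveY] at h1 h2
    rcases Nat.eq_zero_or_pos n with rfl | hn
    · exfalso
      have h3 := mul_one_sub_lt hx
      simp only [Nat.cast_zero, zero_mul, zero_add, add_zero] at h1 b2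
      have hm := cast_pos m (by omega)
      have h4 : 0 < δ * (k * (2 * m)) := by positivity
      have h5 : (0 : ℝ) < i := by
        rw [← h1]
        have : 0 < δ * (k * (2 * m)) * (x * (1 - x)) := mul_pos h4 h3.1
        linarith
      have h6 : (i : ℝ) < 1 := by
        rw [← h1]
        nlinarith
      norm_cast at h5 h6
      omega
    · have := cast_pos n hn
      exact quadratic_inj (a := n) (c := δ * (2 * m + n))
        ((neg_neg_of_pos (by linarith)).trans_le (by positivity)) (by linarith) hx hy
        (mul_left_cancel₀ (show (k : ℝ) ≠ 0 by positivity) (by linear_combination h1 - h2))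
  · intro x hx y hy i h1 h2
    simp only [curveX, curveY] at h1 h2
    exact quadratic_inj (a := m + n) (c := δ * (m - n)) (by linarith) (by linarith) hx hy
      (mul_left_cancel₀ (show (k : ℝ) ≠ 0 by positivity) (by linear_combination h1 - h2))
  · intro x hx hm
    have hm := cast_pos m hm
    obtain ⟨h0, h1⟩ := hx
    have e : curveX m n k δ x = k * x * (m - δ * (m + 2 * n) * (1 - x)) := by
      simp only [curveX]
      ring
    have : 0 < m - δ * (m + 2 * n) * (1 - x) := by
      have : 0 ≤ δ * (m + 2 * n) := by positivity
      nlinarith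
    rw [e]
    positivity
  · intro x hx
    obtain ⟨h0, h1⟩ := hx
    have e : curveX m n k δ x + curveY m n k δ x =
        k * x * (m + n + (δ * m - δ * n) * (1 - x)) := by
      simp only [curveX, curveY]
      ring
    have : 0 < m + n + (δ * m - δ * n) * (1 - x) := by
      have h2 : 0 ≤ δ * m * (1 - x) := mul_nonneg hδm (by linarith)
      have h3 : δ * n * (1 - x) ≤ δ * n := mul_le_of_le_one_right hδn (by linarith)
      linarith
    rw [e]
    positivity
  · have := bound (2 * (m ^ 2 + m * n + n ^ 2) * k) (by nlinarith [mul_nonneg hm0 hn0])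
    linarith

/-- The form of such a lattice point would be an integer strictly between `0` and `1`. -/
lemma SlightlyBent.curveFree {m n k : ℕ} {δ : ℝ} (h : SlightlyBent m n k δ) (hmn : 0 < m + n)
    (hk : 0 < k) (hδ : 0 < δ) : CurveFree m n k δ := by
  intro x h0 h1 r hr0 hr1 v ⟨hx, hy⟩
  have e := curve_slopeForm (m := m) (n := n) (k := k) (δ := r * δ) x
  rw [hx, hy] at e
  have hQ := normForm_pos hmn
  have hkk : (0 : ℝ) < k := by exact_mod_cast hk
  obtain ⟨p0, p1⟩ := mul_one_sub_lt ⟨h0, h1⟩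
  have hlt := h.form_lt
  have hrx : 0 < r * (x * (1 - x)) ∧ r * (x * (1 - x)) < 1 := ⟨by positivity, by nlinarith⟩
  have hc : 0 < 2 * ((m : ℝ) ^ 2 + m * n + n ^ 2) * k * δ := by positivity
  have e' : ((slopeForm m n v : ℤ) : ℝ) =
      2 * (m ^ 2 + m * n + n ^ 2) * k * δ * (r * (x * (1 - x))) := by
    simp only [slopeForm]
    push_cast
    linear_combination e
  have l0 : (0 : ℝ) < slopeForm m n v := by rw [e']; exact mul_pos hc hrx.1
  have l1 : (slopeForm m n v : ℝ) < 1 := by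
    rw [e']
    nlinarith [hrx.1, hrx.2]
  norm_cast at l0 l1
  omega

lemma SlightlyBent.exists_crossing {m n k : ℕ} {δ : ℝ} (h : SlightlyBent m n k δ) :
    ∃ N τ t, PlaneCrossing (curveX m n k δ) (curveY m n k δ) N τ t := by
  have hX := continuous_curveX m n k δ
  have hY := continuous_curveY m n k δ
  have hfin := ((finite_integer_times hX h.fst_inj).union (finite_integer_times hY h.snd_inj)).union
    (finite_integer_times (hX.add hY) h.add_inj)
  obtain ⟨N, τ, t, h1, h2, h3, h4, h5, h6⟩ := exists_triangles hX hY hfin.toFinset 0 1 one_pos (by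
    rintro x hx ⟨i, hi | hi | hi⟩ <;> rw [Set.Finite.mem_toFinset]
    · exact Or.inl (Or.inl ⟨hx, i, hi⟩)
    · exact Or.inl (Or.inr ⟨hx, i, hi⟩)
    · exact Or.inr ⟨hx, i, hi⟩)
  exact ⟨N, τ, t, h1, h2, h3, h4, h5, h6⟩

lemma IsEisTriangle.edge {T : Finset (ℤ × ℤ)} (hT : IsEisTriangle T) {A B : ℤ × ℤ} (hA : A ∈ T)
    (hB : B ∈ T) (hne : A ≠ B) : A.1 = B.1 ∨ A.2 = B.2 ∨ A.1 + A.2 = B.1 + B.2 := by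
  obtain ⟨⟨a, b⟩, σ, hσ, rfl⟩ := isEisTriangle_iff.1 hT
  obtain ⟨c, d⟩ := A
  obtain ⟨e, f⟩ := B
  simp only [tri, Finset.mem_insert, Finset.mem_singleton, Prod.mk.injEq] at hA hB
  simp only
  omega

lemma InTri.exists_pos {T : Finset (ℤ × ℤ)} {x y : ℝ} (h : InTri T x y) (hxy : 0 < x + y) :
    ∃ v ∈ T, 0 < v.1 + v.2 := by
  by_contra! hcon
  obtain ⟨f, h1, -, h3, h4⟩ := h
  have : ∑ v ∈ T, f v * ((v.1 + v.2 : ℤ) : ℝ) ≤ 0 := Finset.sum_nonpos fun v hv =>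
    mul_nonpos_of_nonneg_of_nonpos (h1 v hv) (by exact_mod_cast hcon v hv)
  push_cast at this
  simp only [mul_add, Finset.sum_add_distrib] at this
  linarith

section curve

variable {m n k N : ℕ} {δ : ℝ} {τ : ℕ → Finset (ℤ × ℤ)} {t : ℕ → ℝ}

/-- Two left ends would have form at least `1`, hence so would the crossing point, but `form_lt`
keeps the curve below `1`. -/
lemma SlightlyBent.mixed (h : SlightlyBent m n k δ) (hmn : 0 < m + n) (hk : 0 < k) (hδ : 0 < δ)
    {T T' : Finset (ℤ × ℤ)} {x : ℝ} (hx : x ∈ Set.Ioo (0 : ℝ) 1) {A B U : ℤ × ℤ}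
    (hE : SharedEdge T T' (curveX m n k δ x) (curveY m n k δ x) A B U)
    (hB : 0 < slopeForm m n B) : slopeForm m n A ≤ 0 := by
  by_contra! hA
  obtain ⟨μ, hμ0, hμ1, hx', hy'⟩ := hE.mem
  have e := (slopeForm_add_pos_of_mem hmn hk hδ hx.1 hx.2 hx' hy').1
  have hA' : (1 : ℝ) ≤ slopeForm m n A := by exact_mod_cast hA
  have hB' : (1 : ℝ) ≤ slopeForm m n B := by exact_mod_cast hB
  have hlt := h.form_lt
  obtain ⟨p0, p1⟩ := mul_one_sub_lt hx
  have hQ := normForm_pos hmn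
  have hkk : (0 : ℝ) < k := by exact_mod_cast hk
  have hc : 0 < 2 * ((m : ℝ) ^ 2 + m * n + n ^ 2) * k * δ := by positivity
  have : 2 * ((m : ℝ) ^ 2 + m * n + n ^ 2) * k * (δ * (x * (1 - x))) < 1 := by
    rw [← mul_assoc]
    nlinarith
  nlinarith

/-- On turning back, the points at the times `t (j + 1)` and `t (j + 2)` would both lie on the
lattice line through `A` and `B`, which the curve meets only once. -/
lemma SlightlyBent.noBack (h : SlightlyBent m n k δ)
    (C : PlaneCrossing (curveX m n k δ) (curveY m n k δ) N τ t) {j : ℕ} (hj : j + 2 ≤ N)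
    {A B U : ℤ × ℤ} (hE : SharedEdge (τ j) (τ (j + 1)) (curveX m n k δ (t (j + 1)))
      (curveY m n k δ (t (j + 1))) A B U) : τ j ≠ τ (j + 2) := by
  intro he
  obtain ⟨hT, hT', hdet, μ, hμ0, hμ1, hx, hy⟩ := hE
  obtain ⟨d, hd, hdet⟩ : ∃ d : ℤ, (d = 1 ∨ d = -1) ∧
      (B.1 - A.1) * (U.2 - A.2) - (B.2 - A.2) * (U.1 - A.1) = d := ⟨_, hdet, rfl⟩
  have hdet' : (B.1 - A.1) * ((A + B - U).2 - A.2) - (B.2 - A.2) * ((A + B - U).1 - A.1) = -d := by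
    simp only [Prod.fst_sub, Prod.fst_add, Prod.snd_sub, Prod.snd_add]
    linear_combination -hdet
  have hin := C.mem_right (j := j + 1) (by omega)
  have hin' := C.mem_left (j := j + 1) (by omega)
  rw [show j + 1 + 1 = j + 2 by ring, ← he, hT] at hin
  rw [hT'] at hin'
  have g1 := inTri_det hd hdet hin
  have g2 := inTri_det (d := -d) (by omega) hdet' hin'
  have x1 : t (j + 1) ∈ Set.Ioo (0 : ℝ) 1 := ⟨C.pos (by omega), C.lt_one (by omega)⟩
  have x2 : t (j + 2) ∈ Set.Ioo (0 : ℝ) 1 := ⟨C.pos (j := j + 1) (by omega), C.lt_one (by omega)⟩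
  have hlt := C.lt (j + 1) (by omega)
  have hne : A ≠ B := by
    rintro rfl
    have : d = 0 := by rw [← hdet]; ring
    omega
  have hd0 : (d : ℝ) ≠ 0 := by rcases hd with rfl | rfl <;> norm_num
  have g : (B.1 - A.1) * (curveY m n k δ (t (j + 2)) - A.2) -
      (B.2 - A.2) * (curveX m n k δ (t (j + 2)) - A.1) = 0 := by
    push_cast at g2
    have : d * ((B.1 - A.1) * (curveY m n k δ (t (j + 2)) - A.2) -
      (B.2 - A.2) * (curveX m n k δ (t (j + 2)) - A.1)) = 0 := by linarith
    exact (mul_eq_zero.1 this).resolve_left hd0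
  have hT3 := C.tri j (by omega)
  have key : t (j + 1) = t (j + 2) := by
    rcases hT3.edge (A := A) (B := B) (hT ▸ by simp) (hT ▸ by simp) hne with h1 | h1 | h1
    · have h1' : (A.1 : ℝ) = B.1 := by exact_mod_cast h1
      have h2 : (B.2 : ℝ) - A.2 ≠ 0 := fun h3 =>
        hne (Prod.ext h1 (by exact_mod_cast (sub_eq_zero.1 h3).symm))
      refine h.fst_inj _ x1 _ x2 A.1 (by rw [hx, h1']; ring) ?_
      apply mul_left_cancel₀ h2
      linear_combination -g - (curveY m n k δ (t (j + 2)) - A.2) * h1'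
    · have h1' : (A.2 : ℝ) = B.2 := by exact_mod_cast h1
      have h2 : (B.1 : ℝ) - A.1 ≠ 0 := fun h3 =>
        hne (Prod.ext (by exact_mod_cast (sub_eq_zero.1 h3).symm) h1)
      refine h.snd_inj _ x1 _ x2 A.2 (by rw [hy, h1']; ring) ?_
      apply mul_left_cancel₀ h2
      linear_combination g - (curveX m n k δ (t (j + 2)) - A.1) * h1'
    · have h1' : (A.1 : ℝ) + A.2 = B.1 + B.2 := by exact_mod_cast h1
      have h2 : (B.1 : ℝ) - A.1 ≠ 0 := fun h3 => by
        have h4 : A.1 = B.1 := by exact_mod_cast (sub_eq_zero.1 h3).symm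
        exact hne (Prod.ext h4 (by omega))
      refine h.add_inj _ x1 _ x2 (A.1 + A.2) (by rw [hx, hy]; push_cast; linear_combination -μ * h1')
        ?_
      push_cast
      apply mul_left_cancel₀ h2
      linear_combination g - (curveX m n k δ (t (j + 2)) - A.1) * h1'
  exact hlt.ne key

/-- The crossing of a slightly bent segment is a mixed path. -/
theorem PlaneCrossing.mixedPath_of_slightlyBent
    (C : PlaneCrossing (curveX m n k δ) (curveY m n k δ) N τ t) (h : SlightlyBent m n k δ)
    (hmn : 0 < m + n) (hk : 2 ≤ k) (hδ : 0 < δ) : MixedPath m n N τ := by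
  have hk0 : 0 < k := by omega
  have hfree := h.curveFree hmn hk0 hδ
  have hN := C.length_pos hmn hk
  refine ⟨hN, fun j hj => ?_, fun j hj => ?_, ?_⟩
  · obtain ⟨A, B, U, hE, hB⟩ := C.exists_edge hfree hmn hk0 hδ hj
    exact ⟨A, B, U, hE.left_eq, hE.right_eq,
      h.mixed hmn hk0 hδ ⟨C.pos hj, C.lt_one hj⟩ hE hB, hB⟩
  · obtain ⟨A, B, U, hE, -⟩ := C.exists_edge hfree hmn hk0 hδ (j := j) (by omega)
    exact h.noBack C hj hE
  · obtain ⟨A, B, U, hE, hB⟩ := C.exists_edge hfree hmn hk0 hδ hN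
    have h1 : t (0 + 1) ∈ Set.Ioo (0 : ℝ) 1 := ⟨C.pos hN, C.lt_one hN⟩
    have hA := h.mixed hmn hk0 hδ h1 hE hB
    have hadd := h.add_pos _ h1
    have hfirst : τ 0 = {(0, 0), (0, 1), (1, 0)} ∨ τ 0 = {(0, 0), (-1, 1), (0, 1)} ∨
        τ 0 = {(0, 0), (1, 0), (1, -1)} := by
      refine ((C.tri 0 (Nat.zero_le _)).of_zero_mem C.zero_mem).resolve_right fun h2 => ?_
      obtain ⟨v, hv, hv'⟩ := (C.mem_left hN).exists_pos hadd
      rcases h2 with h2 | h2 | h2 <;> rw [h2] at hv <;>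
        simp only [Finset.mem_insert, Finset.mem_singleton] at hv <;>
        rcases hv with rfl | rfl | rfl <;> simp at hv'
    refine mixed_start hfirst hE.left_eq hE.right_eq hA hB ?_
    -- If `0` were on the exit edge, the sign conditions would make `ω` its other end with `m > 0`;
    -- then the first coordinate vanishes at the crossing, against `fst_pos`.
    rintro rfl
    have mB : B ∈ τ 0 := hE.left_eq ▸ by simp
    obtain ⟨μ, hμ0, hμ1, hx, hy⟩ := hE.mem
    have hfst := h.fst_pos _ h1
    rw [hx] at hadd hfst
    rw [hy] at hadd
    rcases hfirst with h0 | h0 | h0 <;> rw [h0] at mB <;>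
      simp only [Finset.mem_insert, Finset.mem_singleton] at mB <;>
      rcases mB with rfl | rfl | rfl <;> simp [slopeForm] at hB hadd hfst
    all_goals omega

end curve

/-! ### The theorem -/

/-- The first columns of the powers of the two period matrices of a Markov fraction. -/
lemma label_of_isCohn {m n k : ℕ} {P : ℤ × ℤ} (hk : 1 ≤ k) (h : IsCohn m n P) :
    (periodMatrix m n ^ k) 0 0 = companionSeq P.2 k * (2 * P.2 - P.1) - companionSeq P.2 (k - 1) ∧
    (periodMatrix m n ^ k) 1 0 = companionSeq P.2 k * P.2 ∧
    (periodMatrix n m ^ k) 0 0 = companionSeq P.2 k * (P.1 + P.2) - companionSeq P.2 (k - 1) ∧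
    (periodMatrix n m ^ k) 1 0 = companionSeq P.2 k * P.2 := by
  obtain ⟨c, h1, h2, h3⟩ := h
  obtain ⟨j, rfl⟩ : ∃ j, k = j + 1 := ⟨k - 1, by omega⟩
  rw [h1, h2, pow_eq_companionSeq (q := P.2) (by ring) h3,
    pow_eq_companionSeq (q := P.2) (by ring) (by linear_combination h3)]
  simp

lemma label_eq_companion {k : ℕ} (hk : 2 ≤ k) {p q : ℤ} (hq : 0 < q) (s : ℤˣ) {l : ℤ × ℤ}
    (h1 : l.1 = companionSeq q k * p + s * companionSeq q (k - 1))
    (h2 : l.2 = companionSeq q k * q) :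
    0 < l.2 ∧ (l.1 : ℚ) / l.2 = companion s k p q := by
  obtain ⟨j, rfl⟩ : ∃ j, k = j + 1 := ⟨k - 1, by omega⟩
  have hu : 0 < companionSeq q (j + 1) :=
    (companionSeq_mono hq j).1.trans_lt (companionSeq_mono hq j).2
  refine ⟨by rw [h2]; positivity, ?_⟩
  have hq' : (q : ℚ) ≠ 0 := by exact_mod_cast hq.ne'
  have hu' : (companionSeq q (j + 1) : ℚ) ≠ 0 := by exact_mod_cast hu.ne'
  rw [h1, h2, companion]
  push_cast
  field_simp

theorem theorem2p5 (m n : ℕ) (hmn : Nat.Coprime m n) (k : ℕ) (hk : 2 ≤ k) (s : ℤˣ)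
    (p q : ℤ) (hpq : IsMarkovFractionAt n m p q) :
    (∃ ε₀ : ℝ, 0 < ε₀ ∧ ∀ ε : ℝ, 0 < ε → ε < ε₀ →
      LatticeFree m n k s ε ∧
      ∃ (N : ℕ) (τ : ℕ → Finset (ℤ × ℤ)) (L : ℤ × ℤ → ℤ × ℤ),
        CrossesTriangles (bentSegment m n k s ε) N τ ∧
        IsFareyLabelling (startSign n s) N τ L) ∧
    (∀ ε : ℝ, 0 < ε → LatticeFree m n k s ε →
      ∀ (N : ℕ) (τ : ℕ → Finset (ℤ × ℤ)) (L : ℤ × ℤ → ℤ × ℤ),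
        CrossesTriangles (bentSegment m n k s ε) N τ →
        IsFareyLabelling (startSign n s) N τ L →
        ((k * m : ℤ), (k * n : ℤ)) ∈ τ N ∧
        0 < (L ((k * m : ℤ), (k * n : ℤ))).2 ∧
        ((L ((k * m : ℤ), (k * n : ℤ))).1 : ℚ) / (L ((k * m : ℤ), (k * n : ℤ))).2 =
          companion s k p q) := by
  obtain ⟨hq, hcohn⟩ := hpq.spec
  obtain ⟨c1, c2, c3, c4⟩ := label_of_isCohn (k := k) (by omega) hcohn
  have hpos : 0 < m + n := by
    by_contra! h
    obtain ⟨rfl, rfl⟩ : m = 0 ∧ n = 0 := by omega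
    simp at hmn
  have hk0 : 0 < k := by omega
  have h3 : (0 : ℝ) < √3 := by positivity
  have hc : (0 : ℝ) < 4 * k * (m + n + 1) ^ 2 := by positivity
  constructor
  · refine ⟨√3 / (4 * k * (m + n + 1) ^ 2), by positivity, fun ε hε hε' => ?_⟩
    have hδ : 0 < ε / √3 := by positivity
    have hsmall : ε / √3 * (4 * k * (m + n + 1) ^ 2) < 1 := by
      rw [lt_div_iff₀ hc] at hε'
      rw [div_mul_eq_mul_div, div_lt_one h3]
      exact hε'
    rcases Int.units_eq_one_or s with rfl | rfl
    · have hb := slightlyBent_of_small hpos hk0 hδ hsmall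
      obtain ⟨N, τ, t, C⟩ := hb.exists_crossing
      -- The strip needs `l₀ + lₐ = (0, 1)` at `1` and `lₐ = (1, 1)` at `ω`; so `l₀ = (-1, 0)`, the
      -- negative of the label of `0`.
      obtain ⟨L, hL⟩ := (C.mixedPath_of_slightlyBent hb hpos hk hδ).exists_labelling hpos
        (l₀ := (-1, 0)) (lₐ := (1, 1)) (e₀ := (1, 0)) (by simp)
      refine ⟨latticeFree_one.2 (hb.curveFree hpos hk0 hδ), N, τ, L,
        (crossesTriangles_iff (bentSegment_one m n k ε)).2 ⟨t, C⟩, ?_⟩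
      rw [isFareyLabelling_iff]
      simpa [startSign] using hL
    · have hpos' : 0 < n + m := by omega
      have hb := slightlyBent_of_small hpos' hk0 hδ (by rwa [add_comm (n : ℝ)])
      obtain ⟨N, τ, t, C⟩ := hb.exists_crossing
      -- After reflection `lₐ = (0, 1)` and `l₀ = (1, 0)`. For `n = 0` the label of `0` is used and
      -- has to be `-l₀`, which is the reason for writing `∞` as `(-1)/0`.
      obtain ⟨L, hL⟩ := (C.mixedPath_of_slightlyBent hb hpos' hk hδ).exists_labelling hpos'
        (l₀ := (1, 0)) (lₐ := (0, 1)) (e₀ := (startSign n (-1), 0)) (by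
          rintro rfl
          simp [startSign])
      refine ⟨latticeFree_neg_one.2 (hb.curveFree hpos' hk0 hδ), N, fun j => swapTri (τ j),
        fun v => L v.swap,
        (crossesTriangles_iff (bentSegment_neg_one m n k ε)).2 ⟨t, C.swap⟩, ?_⟩
      rw [isFareyLabelling_iff]
      simpa using hL.swap
  · intro ε hε hfree N τ L hC hL
    have hδ : 0 < ε / √3 := by positivity
    rw [isFareyLabelling_iff] at hL
    rcases Int.units_eq_one_or s with rfl | rfl
    · obtain ⟨t, C⟩ := (crossesTriangles_iff (bentSegment_one m n k ε)).1 hC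
      have M := C.mixedPath_of_labelled (latticeFree_one.1 hfree) hpos hk hδ hL
      refine ⟨C.end_mem, label_eq_companion hk hq 1 ?_ ?_⟩ <;>
      -- The numerator is `-(u_k (2q - p) - u_{k-1}) + 2 u_k q = u_k p + u_{k-1}`.
      rw [M.label_eq hpos (l₀ := (-1, 0)) (lₐ := (1, 1)) hL (by simp [startSign]) hk C.end_mem,
        c1, c2]
      · simp
        ring
      · simp
    · obtain ⟨t, C'⟩ := (crossesTriangles_iff (bentSegment_neg_one m n k ε)).1 hC
      have C := C'.swap
      have hpos' : 0 < n + m := by omega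
      have M := C.mixedPath_of_labelled (latticeFree_neg_one.1 hfree) hpos' hk hδ hL.swap
      have hl := M.label_eq hpos' (l₀ := (1, 0)) (lₐ := (0, 1)) (L := fun v => L v.swap)
        (by simpa using hL.swap) (by rintro rfl; simp [startSign]) hk C.end_mem
      simp only [Prod.swap_prod_mk] at hl
      refine ⟨by simpa using mem_swapTri.1 C.end_mem, label_eq_companion hk hq (-1) ?_ ?_⟩ <;>
      -- The mirrored matrix gives `(u_k (p + q) - u_{k-1}) - u_k q = u_k p - u_{k-1}`.
      rw [hl, c3, c4]
      · simp
        ring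
      · simp
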